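/- Let $A\in\mathbb R^{n\times n}$, $B_i\in\mathbb R^{n\times m_i}$ ($i=1,\dots,N$), $m=\sum_i m_i$, with $(A,[B_1\ \cdots\ B_N])$ controllable, and let $Q_i\succeq 0$, $R_{ii}\succ 0$, $R_{ij}\succeq 0$ ($j\ne i$) be the weights of the game with dynamics $\dot x=Ax+\sum_i B_iu_i$ and costs $J_i=\int_0^\infty\big(x^\top Q_ix+u_i^\top R_{ii}u_i+\sum_{j\ne i}u_j^\top R_{ij}u_j\big)dt$. For matrices $K_i\in\mathbb R^{m_i\times n}$ put $\bar Q_i(K)=Q_i+K_i^\top R_{ii}K_i+\sum_{j\neq i}K_j^\top R_{ij}K_j$ and $A_c(K)=A-\sum_i B_iK_i$. **Data.** Let $T>0$, and let $(x,u_1,\dots,u_N)$ be an input-state trajectory of the system on $[0,\eta T]$ whose input $u=[u_1^\top\cdots u_N^\top]^\top$ is piecewise constant persistently exciting (PCPE) of order $L=n+1$, that is: $u(t+jT)=\mu_j$ for $0\le t<T$, $j=0,\dots,\eta-1$; the block Hankel matrix with $L$ block rows and $\eta-L+1$ columns built from $\mu_0,\dots,\mu_{\eta-1}$ has rank $mL$;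 and $T$ is a non-pathological sampling time (no two distinct eigenvalues of $A$ with equal real parts have imaginary parts that differ by an integer multiple of $2\pi/T$). Let $\tilde{\mathcal H}_S(x)$ have the columns $x((j+1)T)-x(jT)$, and let $\mathcal H_S(x)$, $\mathcal H_S(u_i)$ have the columns $\int_{jT}^{(j+1)T}x\,dt$, $\int_{jT}^{(j+1)T}u_i\,dt$, for $j=0,\dots,\eta-1$; let $\mathcal H_S(u)$ be the stack of the $\mathcal H_S(u_i)$. **Algorithm 1 (model-based).** Start with $K_i^0$ such that $A_c(K^0)$ is Hurwitz. For $k=0,1,\dots$ take $P_i^k\succ0$ with $P_i^kA_c(K^k)+A_c(K^k)^\top P_i^k=-\bar Q_i(K^k)$ and set $K_i^{k+1}=R_{ii}^{-1}B_i^\top P_i^k$, for $i=1,\dots,N$. **Algorithm 2 (data-based).** *Initialization.* Fix $\mathcal Q\succeq0$ and let $\mathcal P$ be a maximizer of $\operatorname{tr}P$ subject to $P\succ0$ and $\mathcal L(P)\succeq0$, where $\mathcal L(P)=\mathcal H_S(x)^\top\mathcal Q\mathcal H_S(x)+\mathcal H_S(u)^\top\operatorname{blkdiag}(R_{11},\dots,R_{NN})\mathcal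 H_S(u)+\mathcal H_S(x)^\top P\tilde{\mathcal H}_S(x)+\tilde{\mathcal H}_S(x)^\top P\mathcal H_S(x)$. Take $\Gamma^0$ with $\mathcal H_S(x)\Gamma^0=I$, $\mathcal L(\mathcal P)\Gamma^0=0$; set $K_i^0=-\mathcal H_S(u_i)\Gamma^0$; take $\bar\Gamma_i$ with $\mathcal H_S(x)\bar\Gamma_i=I$, $\mathcal H_S(u_i)\bar\Gamma_i=0$, $\mathcal H_S(u_j)\bar\Gamma_i=-K_j^0$ ($j\ne i$); set $S_i=\tilde{\mathcal H}_S(x)(\bar\Gamma_i-\Gamma^0)\mathcal P^{-1}$. *Iteration* ($k=0,1,\dots$). Take $\Gamma^k$ with $\mathcal H_S(x)\Gamma^k=I$, $\mathcal H_S(u_j)\Gamma^k=-K_j^k$ for all $j$; for each $i$ take $\Phi_i^k$ with $\mathcal H_S(x)\Phi_i^k=\mathcal H_S(x)$, $\mathcal H_S(u_j)\Phi_i^k=-K_j^k\mathcal H_S(x)$ for $j\ne i$, and $\mathcal H_S(u_i)\Phi_i^k=-K_i^k\mathcal H_S(x)+\mathcal H_S(u_i)$; take $P_i^k\succ0$ with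 $P_i^k\tilde{\mathcal H}_S(x)\Gamma^k+(\Gamma^k)^\top\tilde{\mathcal H}_S(x)^\top P_i^k=-\bar Q_i(K^k)$; take $\bar\Gamma_i^k$ with $$\begin{bmatrix}\mathcal H_S(x)\\ \bar{\mathcal L}_i^k(P_i^k)\end{bmatrix}\bar\Gamma_i^k=\begin{bmatrix}I\\0\end{bmatrix},$$ where $\bar{\mathcal L}_i^k(P)=\mathcal H_S(x)^\top(\bar Q_i(K^k)+PS_iP)\mathcal H_S(x)+\mathcal H_S(u_i)^\top R_{ii}\mathcal H_S(u_i)+\mathcal H_S(x)^\top P\tilde{\mathcal H}_S(x)\Phi_i^k+(\Phi_i^k)^\top\tilde{\mathcal H}_S(x)^\top P\mathcal H_S(x)$; and set $K_i^{k+1}=-\mathcal H_S(u_i)\bar\Gamma_i^k$. **Theorem.** Under these assumptions, for every $\mathcal Q\succeq0$: 1. For every maximizer $\mathcal P$ the remaining steps of the initialization of Algorithm 2 can be carried out, and for all matrices $K_i^k$ suitable $\Gamma^k$ and $\Phi_i^k$ exist. 2. Every $K^0$ produced by the initialization makes $A_c(K^0)$ Hurwitz, so it is an admissible start of Algorithm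 1. 3. Algorithms 1 and 2 are equivalent: for every result $(K^0,S)$ of the initialization and every $M$, the sequences $(P_i^k)_{k<M}$, $(K_i^{k})_{k\le M}$ that $M$ iterations of Algorithm 2 can produce (with whatever choices of the auxiliary matrices) are exactly those that $M$ iterations of Algorithm 1 started at the same $K^0$ can produce. In particular, if $A_c(K^k)$ is Hurwitz for all $k<M$ along a run of Algorithm 1 started at $K^0$, then any run of Algorithm 2 from $(K^0,S)$ yields the same matrices $P_i^k$ and $K_i^{k+1}$ for all $i$ and all $k<M$. -/

import Mathlib

namespace NZSGame

noncomputable section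

open Matrix

/-! ### Linear systems -/

/-- A real square matrix is Hurwitz if all its complex eigenvalues have negative real part. -/
def IsHurwitz {n : ℕ} (A : Matrix (Fin n) (Fin n) ℝ) : Prop :=
  ∀ z ∈ spectrum ℂ (A.map (fun a : ℝ => (a : ℂ))), z.re < 0

/-- The block row `[B_1 ⋯ B_N]`. -/
def stackCols {n N : ℕ} {m : Fin N → ℕ} (B : ∀ i, Matrix (Fin n) (Fin (m i)) ℝ) :
    Matrix (Fin n) (Σ i, Fin (m i)) ℝ :=
  Matrix.of fun r p => B p.1 r p.2

/-- The block column with blocks `U_1, …, U_N`. -/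
def stackRows {η N : ℕ} {m : Fin N → ℕ} (U : ∀ i, Matrix (Fin (m i)) (Fin η) ℝ) :
    Matrix (Σ i, Fin (m i)) (Fin η) ℝ :=
  Matrix.of fun p c => U p.1 p.2 c

/-- The pair `(A, B)` is controllable: `[B, AB, …, A^(n-1) B]` has rank `n`. -/
def IsControllable {n : ℕ} {κ : Type*} [Fintype κ]
    (A : Matrix (Fin n) (Fin n) ℝ) (B : Matrix (Fin n) κ ℝ) : Prop :=
  (Matrix.of fun (r : Fin n) (p : Fin n × κ) => (A ^ (p.1 : ℕ) * B) r p.2).rank = n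

/-- `T` is a non-pathological sampling time for `A`: no two distinct eigenvalues of `A` with equal
real parts have imaginary parts that differ by an integer multiple of `2π / T`. -/
def IsNonpathological {n : ℕ} (A : Matrix (Fin n) (Fin n) ℝ) (T : ℝ) : Prop :=
  ∀ z ∈ spectrum ℂ (A.map (fun a : ℝ => (a : ℂ))),
    ∀ w ∈ spectrum ℂ (A.map (fun a : ℝ => (a : ℂ))),
      z ≠ w → z.re = w.re → ∀ k : ℤ, z.im - w.im ≠ 2 * Real.pi * k / T

/-- `(x, u)` is an input-state trajectory of `x' = A x + ∑ i, B_i u_i` on `[0, τ]`, in the sense of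
Carathéodory (the inputs may jump): `x` is continuous, the inputs are integrable, and the
integrated differential equation holds. -/
def IsTrajectory {n N : ℕ} {m : Fin N → ℕ} (A : Matrix (Fin n) (Fin n) ℝ)
    (B : ∀ i, Matrix (Fin n) (Fin (m i)) ℝ) (τ : ℝ)
    (x : ℝ → Fin n → ℝ) (u : ∀ i, ℝ → Fin (m i) → ℝ) : Prop :=
  ContinuousOn x (Set.Icc 0 τ) ∧
  (∀ i, IntervalIntegrable (u i) MeasureTheory.volume 0 τ) ∧
  ∀ t ∈ Set.Icc 0 τ, x t = x 0 + ∫ s in (0 : ℝ)..t, (A *ᵥ x s + ∑ i, B i *ᵥ u i s)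

/-! ### Persistently exciting data -/

/-- The block Hankel matrix with `L` block rows built from `μ_0, …, μ_(η-1)`.
It has `η - L + 1` columns (none if `η < L`). -/
def blockHankel {κ : Type*} (η L : ℕ) (μ : ℕ → κ → ℝ) :
    Matrix (Fin L × κ) (Fin (η + 1 - L)) ℝ :=
  Matrix.of fun p c => μ (p.1 + c) p.2

/-- The concatenated input `u = [u_1; …; u_N]` is, on `[0, ηT)`, a piecewise constant persistently
exciting (PCPE) input of order `L` for a system with state matrix `A`. -/
def IsPCPE {n N : ℕ} {m : Fin N → ℕ} (A : Matrix (Fin n) (Fin n) ℝ) (η : ℕ) (T : ℝ) (L : ℕ)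
    (u : ∀ i, ℝ → Fin (m i) → ℝ) : Prop :=
  ∃ μ : ℕ → (Σ i, Fin (m i)) → ℝ,
    (∀ j < η, ∀ t, 0 ≤ t → t < T → ∀ p : Σ i, Fin (m i), u p.1 (t + j * T) p.2 = μ j p) ∧
    (blockHankel η L μ).rank = (∑ i, m i) * L ∧
    IsNonpathological A T

/-- `[f(t), f(t+T), …, f(t+(η-1)T)]`. -/
def hankelRow {κ : Type*} (η : ℕ) (T : ℝ) (f : ℝ → κ → ℝ) (t : ℝ) : Matrix κ (Fin η) ℝ :=
  Matrix.of fun a c => f (t + (c : ℕ) * T) a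

/-- The entrywise integral over `[0, T]` of `t ↦ hankelRow η T f t`. -/
def hankelInt {κ : Type*} (η : ℕ) (T : ℝ) (f : ℝ → κ → ℝ) : Matrix κ (Fin η) ℝ :=
  Matrix.of fun a c => ∫ t in (0 : ℝ)..T, hankelRow η T f t a c

/-- The matrices that the data-based algorithm works with. -/
structure DataMatrices (n N : ℕ) (m : Fin N → ℕ) (η : ℕ) where
  /-- the increments of the state over the sampling intervals -/
  Xd : Matrix (Fin n) (Fin η) ℝ
  /-- the integrals of the state over the sampling intervals -/
  X : Matrix (Fin n) (Fin η) ℝ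
  /-- the integrals of the inputs over the sampling intervals -/
  U : ∀ i, Matrix (Fin (m i)) (Fin η) ℝ

/-- The data matrices of a measured input-state trajectory. -/
def collect {n N : ℕ} {m : Fin N → ℕ} (η : ℕ) (T : ℝ)
    (x : ℝ → Fin n → ℝ) (u : ∀ i, ℝ → Fin (m i) → ℝ) : DataMatrices n N m η where
  Xd := hankelRow η T x T - hankelRow η T x 0
  X := hankelInt η T x
  U := fun i => hankelInt η T (u i)

/-! ### The game and the model-based iteration -/

/-- The weights of the costs
`J_i = ∫ xᵀ Q_i x + u_iᵀ R_ii u_i + ∑ j ≠ i, u_jᵀ R_ij u_j`. -/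
structure Weights (n N : ℕ) (m : Fin N → ℕ) where
  Q : Fin N → Matrix (Fin n) (Fin n) ℝ
  R : ∀ _i j : Fin N, Matrix (Fin (m j)) (Fin (m j)) ℝ

/-- `Q_i ⪰ 0`, `R_ii ≻ 0`, and `R_ij ⪰ 0`. -/
def Weights.Admissible {n N : ℕ} {m : Fin N → ℕ} (w : Weights n N m) : Prop :=
  (∀ i, (w.Q i).PosSemidef) ∧ (∀ i, (w.R i i).PosDef) ∧
    ∀ i j, j ≠ i → (w.R i j).PosSemidef

/-- `Q_i + K_iᵀ R_ii K_i + ∑ j ≠ i, K_jᵀ R_ij K_j`. -/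
def Weights.Qbar {n N : ℕ} {m : Fin N → ℕ} (w : Weights n N m)
    (K : ∀ i, Matrix (Fin (m i)) (Fin n) ℝ) (i : Fin N) : Matrix (Fin n) (Fin n) ℝ :=
  w.Q i + (K i)ᵀ * w.R i i * K i + ∑ j ∈ Finset.univ.erase i, (K j)ᵀ * w.R i j * K j

/-- `A - ∑ i, B_i K_i`. -/
def closedLoop {n N : ℕ} {m : Fin N → ℕ} (A : Matrix (Fin n) (Fin n) ℝ)
    (B : ∀ i, Matrix (Fin n) (Fin (m i)) ℝ) (K : ∀ i, Matrix (Fin (m i)) (Fin n) ℝ) :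
    Matrix (Fin n) (Fin n) ℝ :=
  A - ∑ i, B i * K i

/-- One iteration of the model-based algorithm: from the feedback matrices `K`, the `P_i ≻ 0` solve
the decoupled Lyapunov equations, and `K'` are the updated feedback matrices. -/
def ModelStep {n N : ℕ} {m : Fin N → ℕ} (A : Matrix (Fin n) (Fin n) ℝ)
    (B : ∀ i, Matrix (Fin n) (Fin (m i)) ℝ) (w : Weights n N m)
    (K : ∀ i, Matrix (Fin (m i)) (Fin n) ℝ) (P : Fin N → Matrix (Fin n) (Fin n) ℝ)
    (K' : ∀ i, Matrix (Fin (m i)) (Fin n) ℝ) : Prop :=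
  (∀ i, (P i).PosDef ∧
    P i * closedLoop A B K + (closedLoop A B K)ᵀ * P i = -w.Qbar K i) ∧
  ∀ i, K' i = (w.R i i)⁻¹ * (B i)ᵀ * P i

/-- `(K^0, …, K^M)` and `(P^0, …, P^(M-1))` are produced by `M` iterations of the model-based
algorithm, started at a stabilizing `K^0`. -/
def ModelRun {n N : ℕ} {m : Fin N → ℕ} (A : Matrix (Fin n) (Fin n) ℝ)
    (B : ∀ i, Matrix (Fin n) (Fin (m i)) ℝ) (w : Weights n N m) (M : ℕ)
    (K : ℕ → ∀ i, Matrix (Fin (m i)) (Fin n) ℝ)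
    (P : ℕ → Fin N → Matrix (Fin n) (Fin n) ℝ) : Prop :=
  IsHurwitz (closedLoop A B (K 0)) ∧ ∀ k < M, ModelStep A B w (K k) (P k) (K (k + 1))

/-! ### The data-based iteration (the system matrices do not occur in this section) -/

variable {n N : ℕ} {m : Fin N → ℕ} {η : ℕ}

/-- The operator `𝓛(P)` of the auxiliary LQR problem with state weight `Qa` and input weight
`blkdiag(R_11, …, R_NN)`. -/
def lqrOp (d : DataMatrices n N m η) (w : Weights n N m) (Qa P : Matrix (Fin n) (Fin n) ℝ) :
    Matrix (Fin η) (Fin η) ℝ :=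
  d.Xᵀ * Qa * d.X
    + (stackRows d.U)ᵀ * Matrix.blockDiagonal' (fun i => w.R i i) * stackRows d.U
    + d.Xᵀ * P * d.Xd + d.Xdᵀ * P * d.X

/-- `Pa` solves: maximize `tr P` subject to `P ≻ 0`, `𝓛(P) ⪰ 0`. -/
def SolvesLQR (d : DataMatrices n N m η) (w : Weights n N m)
    (Qa Pa : Matrix (Fin n) (Fin n) ℝ) : Prop :=
  (Pa.PosDef ∧ (lqrOp d w Qa Pa).PosSemidef) ∧
    ∀ P : Matrix (Fin n) (Fin n) ℝ, P.PosDef → (lqrOp d w Qa P).PosSemidef →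
      P.trace ≤ Pa.trace

/-- The initialization of the data-based algorithm computes the feedback matrices `K0` and the
matrices `S_i`, from a solution `Pa` of the optimization problem with state weight `Qa`, a solution
`Γ0` of `[X; 𝓛(Pa)] Γ0 = [I; 0]`, and matrices `Γz_i` that satisfy the closed-loop equations of `K0`
with `K0_i` replaced by zero. -/
def DataInit (d : DataMatrices n N m η) (w : Weights n N m) (Qa Pa : Matrix (Fin n) (Fin n) ℝ)
    (K0 : ∀ i, Matrix (Fin (m i)) (Fin n) ℝ) (S : Fin N → Matrix (Fin n) (Fin n) ℝ) : Prop :=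
  SolvesLQR d w Qa Pa ∧
  ∃ (Γ0 : Matrix (Fin η) (Fin n) ℝ) (Γz : Fin N → Matrix (Fin η) (Fin n) ℝ),
    d.X * Γ0 = 1 ∧ lqrOp d w Qa Pa * Γ0 = 0 ∧
    (∀ i, K0 i = -(d.U i * Γ0)) ∧
    (∀ i, d.X * Γz i = 1 ∧ d.U i * Γz i = 0 ∧ ∀ j, j ≠ i → d.U j * Γz i = -K0 j) ∧
    ∀ i, S i = d.Xd * (Γz i - Γ0) * Pa⁻¹

/-- `Γ` satisfies `[X; U_1; …; U_N] Γ = [I; -K_1; …; -K_N]`. -/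
def SolvesGamma (d : DataMatrices n N m η) (K : ∀ i, Matrix (Fin (m i)) (Fin n) ℝ)
    (Γ : Matrix (Fin η) (Fin n) ℝ) : Prop :=
  d.X * Γ = 1 ∧ ∀ j, d.U j * Γ = -K j

/-- `Φ` satisfies `[X; U_1; …; U_N] Φ = [X; -K_1 X; …; -K_i X + U_i; …; -K_N X]`, where only the
`i`-th input block has the extra term. -/
def SolvesPhi (d : DataMatrices n N m η) (K : ∀ i, Matrix (Fin (m i)) (Fin n) ℝ) (i : Fin N)
    (Φ : Matrix (Fin η) (Fin η) ℝ) : Prop :=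
  d.X * Φ = d.X ∧ ∀ j, d.U j * Φ = -(K j * d.X) + if j = i then d.U j else 0

/-- The operator `P ↦ 𝓛̄_i(P)` formed with `K`, `S_i` and `Φ_i`. -/
def Lbar (d : DataMatrices n N m η) (w : Weights n N m) (S : Fin N → Matrix (Fin n) (Fin n) ℝ)
    (K : ∀ i, Matrix (Fin (m i)) (Fin n) ℝ) (i : Fin N) (Φ : Matrix (Fin η) (Fin η) ℝ)
    (P : Matrix (Fin n) (Fin n) ℝ) : Matrix (Fin η) (Fin η) ℝ :=
  d.Xᵀ * (w.Qbar K i + P * S i * P) * d.X + (d.U i)ᵀ * w.R i i * d.U i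
    + d.Xᵀ * P * d.Xd * Φ + Φᵀ * d.Xdᵀ * P * d.X

/-- One iteration of the data-based algorithm, from `K` through `P` to `K'`. The auxiliary matrices
`Γ`, `Φ_i`, `Γb_i` may be any solutions of their equations. -/
def DataStep (d : DataMatrices n N m η) (w : Weights n N m)
    (S : Fin N → Matrix (Fin n) (Fin n) ℝ)
    (K : ∀ i, Matrix (Fin (m i)) (Fin n) ℝ) (P : Fin N → Matrix (Fin n) (Fin n) ℝ)
    (K' : ∀ i, Matrix (Fin (m i)) (Fin n) ℝ) : Prop :=
  ∃ (Γ : Matrix (Fin η) (Fin n) ℝ) (Φ : Fin N → Matrix (Fin η) (Fin η) ℝ)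
    (Γb : Fin N → Matrix (Fin η) (Fin n) ℝ),
    SolvesGamma d K Γ ∧ (∀ i, SolvesPhi d K i (Φ i)) ∧
    (∀ i, (P i).PosDef ∧ P i * d.Xd * Γ + Γᵀ * d.Xdᵀ * P i = -w.Qbar K i) ∧
    (∀ i, d.X * Γb i = 1 ∧ Lbar d w S K i (Φ i) (P i) * Γb i = 0) ∧
    ∀ i, K' i = -(d.U i * Γb i)

/-- `(K^0, …, K^M)` and `(P^0, …, P^(M-1))` are produced by `M` iterations of the data-based
algorithm, started at the result `(K0, S)` of its initialization. -/
def DataRun (d : DataMatrices n N m η) (w : Weights n N m)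
    (K0 : ∀ i, Matrix (Fin (m i)) (Fin n) ℝ) (S : Fin N → Matrix (Fin n) (Fin n) ℝ) (M : ℕ)
    (K : ℕ → ∀ i, Matrix (Fin (m i)) (Fin n) ℝ)
    (P : ℕ → Fin N → Matrix (Fin n) (Fin n) ℝ) : Prop :=
  K 0 = K0 ∧ ∀ k < M, DataStep d w S (K k) (P k) (K (k + 1))

end

end NZSGame

/-! The data matrices, written X, U_i, Xd, carry exactly the information of the model. Integrating
the dynamics over each sampling interval gives Xd = A X + ∑ B_i U_i (`collect_Xd`), and the stack of
X and all U_i has full row rank (`collect_left_kernel`), so X Γ and U_i Γ can be prescribed at will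
(`collect_exists_solution`).

For the rank, a left null vector (ξ, ν) gives, on every interval, a linear relation between the
sampled state x(jT) and the input value μ_j. The samples obey a discrete system with matrices
exp(TA) and G B, where G = ∫₀ᵀ exp(sA) ds. Willems' lemma (`willems`) kills the input part of the
relation and makes ξG annihilate the reachable space of this system. Non-pathological sampling
preserves controllability (`sampled_controllable`) and makes G injective, so ξ = 0 and then ν = 0.

Everything else is completing squares. With K = R⁻¹BᵀP, the operator 𝓛(P) is Xᵀ Ric(P) X + (U + KX)ᵀ
R (U + KX), where Ric is the Riccati map (`lqrOp_eq`). By richness of the data, P ≻ 0 is feasible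
iff Ric(P) ⪰ 0. A feasible P with Ric(P) ≠ 0 can be enlarged (`exists_larger_riccati`), so a trace
maximizer solves the Riccati equation. Then 𝓛(P)Γ⁰ = 0 forces K⁰ = R⁻¹BᵀP, which is stabilizing
(`hurwitz_of_riccati`), and S_i = B_i R_ii⁻¹ B_iᵀ follows.

In the iteration, Xd Γ is the closed loop, so both algorithms have the same Lyapunov equations. Once
P_i solves its equation, 𝓛̄_i(P_i) is the single square of U_i + R_ii⁻¹B_iᵀP_i X in the weight R_ii
(`Lbar_eq`), and its kernel condition forces K_i' = R_ii⁻¹B_iᵀP_i. This gives `dataStep_iff`. The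
agreement of runs along Hurwitz closed loops is uniqueness for the Lyapunov equation
(`lyapunov_unique`). -/

namespace NZSGame
open Matrix

/-! ### Full row rank and trivial left kernels. -/

section LeftKernel

variable {ι κ : Type*} [Fintype ι] [Fintype κ]

theorem vecMul_eq_zero_of_rank_eq_card {M : Matrix ι κ ℝ} (h : M.rank = Fintype.card ι)
    {v : ι → ℝ} (hv : v ᵥ* M = 0) : v = 0 := by
  have hli : LinearIndependent ℝ M.row := by
    rw [linearIndependent_iff_card_eq_finrank_span, ← h, Matrix.rank_eq_finrank_span_row]
    rfl
  have := Matrix.vecMul_injective_iff.2 hli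
  exact this (by simpa using hv)

theorem vecMul_map_ofReal_re_im {ν : Type*} (M : Matrix ι ν ℝ) (c : ι → ℂ) (k : ν) :
    ((c ᵥ* M.map (fun a : ℝ => (a : ℂ))) k).re = ((fun i => (c i).re) ᵥ* M) k ∧
    ((c ᵥ* M.map (fun a : ℝ => (a : ℂ))) k).im = ((fun i => (c i).im) ᵥ* M) k := by
  simp [Matrix.vecMul, dotProduct]

/-- Since M is real, its complex left kernel splits into real and imaginary parts. This moves real
rank conditions to ℂ, where eigenvectors are available. -/
theorem complex_vecMul_eq_zero {ν : Type*} {M : Matrix ι ν ℝ} (h : ∀ v : ι → ℝ, v ᵥ* M = 0 → v = 0)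
    {c : ι → ℂ} (hc : c ᵥ* M.map (fun a : ℝ => (a : ℂ)) = 0) : c = 0 := by
  have h1 := h (fun i => (c i).re) (by
    ext k; rw [← (vecMul_map_ofReal_re_im M c k).1, hc]; simp)
  have h2 := h (fun i => (c i).im) (by
    ext k; rw [← (vecMul_map_ofReal_re_im M c k).2, hc]; simp)
  ext i
  exact Complex.ext (congrFun h1 i) (congrFun h2 i)

theorem exists_mul_eq_one_of_left_kernel [DecidableEq ι] {M : Matrix ι κ ℝ}
    (h : ∀ v : ι → ℝ, v ᵥ* M = 0 → v = 0) : ∃ Z : Matrix κ ι ℝ, M * Z = 1 := by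
  classical
  have hinj : Function.Injective M.vecMul := by
    intro v w hvw
    exact sub_eq_zero.1 (h (v - w) (by rw [Matrix.sub_vecMul]; exact sub_eq_zero.2 hvw))
  have hli := Matrix.vecMul_injective_iff.1 hinj
  have hr := hli.rank_matrix
  have hs : Function.Surjective M.mulVecLin := by
    rw [← LinearMap.range_eq_top]
    apply Submodule.eq_top_of_finrank_eq
    rw [Module.finrank_fintype_fun_eq_card]
    exact hr
  exact Matrix.mulVec_surjective_iff_exists_right_inverse.1 hs

end LeftKernel

/-! ### Eigenvectors of complex matrices in invariant subspaces. -/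

section Eigenvectors

variable {n : ℕ}

theorem mem_spectrum_of_vecMul {M : Matrix (Fin n) (Fin n) ℂ} {z : ℂ} {v : Fin n → ℂ}
    (hv : v ≠ 0) (h : v ᵥ* M = z • v) : z ∈ spectrum ℂ M := by
  rw [spectrum.mem_iff, Matrix.isUnit_iff_isUnit_det, isUnit_iff_ne_zero, not_not,
    ← Matrix.exists_vecMul_eq_zero_iff]
  refine ⟨v, hv, ?_⟩
  rw [Matrix.vecMul_sub, h, Algebra.algebraMap_eq_smul_one, Matrix.vecMul_smul, Matrix.vecMul_one,
    sub_self]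

theorem exists_mulVec_of_mem_spectrum {M : Matrix (Fin n) (Fin n) ℂ} {z : ℂ}
    (h : z ∈ spectrum ℂ M) : ∃ v : Fin n → ℂ, v ≠ 0 ∧ M *ᵥ v = z • v := by
  rw [spectrum.mem_iff, Matrix.isUnit_iff_isUnit_det, isUnit_iff_ne_zero, not_not,
    ← Matrix.exists_mulVec_eq_zero_iff] at h
  obtain ⟨v, hv, h⟩ := h
  refine ⟨v, hv, ?_⟩
  rw [Matrix.sub_mulVec, Algebra.algebraMap_eq_smul_one, Matrix.smul_mulVec, Matrix.one_mulVec,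
    sub_eq_zero] at h
  exact h.symm

/-- The restriction to a nonzero invariant subspace has an eigenvalue because ℂ is algebraically
closed. The sampling arguments reduce to single eigenvectors through this lemma. -/
theorem exists_left_eigenvector_mem (M : Matrix (Fin n) (Fin n) ℂ) (Y : Submodule ℂ (Fin n → ℂ))
    (hY : ∀ y ∈ Y, y ᵥ* M ∈ Y) (hne : Y ≠ ⊥) :
    ∃ (z : ℂ) (y : Fin n → ℂ), y ∈ Y ∧ y ≠ 0 ∧ y ᵥ* M = z • y := by
  have : Nontrivial Y := Submodule.nontrivial_iff_ne_bot.2 hne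
  obtain ⟨z, hz⟩ := Module.End.exists_eigenvalue (M.vecMulLinear.restrict hY)
  obtain ⟨y, hy⟩ := hz.exists_hasEigenvector
  refine ⟨z, y, y.2, fun h => hy.2 (Subtype.ext h), ?_⟩
  exact congrArg Subtype.val hy.apply_eq_smul

/-- Eigenvalues of a complexified real matrix come in conjugate pairs. -/
theorem conj_mem_spectrum {A : Matrix (Fin n) (Fin n) ℝ} {z : ℂ}
    (h : z ∈ spectrum ℂ (A.map (fun a : ℝ => (a : ℂ)))) :
    (starRingEnd ℂ) z ∈ spectrum ℂ (A.map (fun a : ℝ => (a : ℂ))) := by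
  rw [spectrum.mem_iff, Matrix.isUnit_iff_isUnit_det, isUnit_iff_ne_zero, not_not,
    ← Matrix.exists_vecMul_eq_zero_iff] at h
  obtain ⟨v, hv, h⟩ := h
  rw [Matrix.vecMul_sub, Algebra.algebraMap_eq_smul_one, Matrix.vecMul_smul, Matrix.vecMul_one,
    sub_eq_zero] at h
  refine mem_spectrum_of_vecMul (v := star v) (by simpa using hv) ?_
  have := congrArg star h
  ext k
  have hk := congrFun this k
  simp only [Pi.star_apply, Pi.smul_apply, smul_eq_mul, star_mul', Matrix.vecMul, dotProduct,
    Matrix.map_apply, star_sum] at hk ⊢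
  rw [← starRingEnd_apply, ← starRingEnd_apply] at hk
  rw [← starRingEnd_apply, hk]
  simp

end Eigenvectors

/-! ### Cayley–Hamilton and Willems' fundamental lemma. -/

section Willems

variable {K κ : Type*} [Field K] [Fintype κ] {n : ℕ}

theorem pow_eq_sum_charpoly (E : Matrix (Fin n) (Fin n) K) :
    E ^ n = -∑ k ∈ Finset.range n, E.charpoly.coeff k • E ^ k := by
  have h := Matrix.aeval_self_charpoly E
  have hm := Matrix.charpoly_monic E
  by_cases hn : n = 0
  · subst hn
    exact Subsingleton.elim _ _
  have : Nonempty (Fin n) := ⟨⟨0, Nat.pos_of_ne_zero hn⟩⟩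
  have hd : E.charpoly.natDegree = n := by
    simp [Matrix.charpoly_natDegree_eq_dim]
  rw [Polynomial.aeval_eq_sum_range, Finset.sum_range_succ, hm.coeff_natDegree, one_smul, hd,
    add_comm] at h
  exact eq_neg_of_add_eq_zero_left h

theorem vecMul_pow_mul_eq_zero {ν : Type*} (E : Matrix (Fin n) (Fin n) K)
    (B : Matrix (Fin n) ν K) (v : Fin n → K) (h : ∀ i < n, v ᵥ* (E ^ i * B) = 0) (i : ℕ) : v ᵥ* (E ^ i * B) = 0 := by
  induction i using Nat.strong_induction_on with
  | _ i ih =>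
    by_cases hi : i < n
    · exact h i hi
    have : E ^ i * B = -∑ k ∈ Finset.range n, E.charpoly.coeff k • (E ^ (i - n + k) * B) := by
      rw [show E ^ i = E ^ (i - n) * E ^ n by rw [← pow_add]; congr 1; omega, pow_eq_sum_charpoly,
        mul_neg, Finset.mul_sum, Matrix.neg_mul, Matrix.sum_mul]
      simp [pow_add, Matrix.mul_assoc]
    rw [this, Matrix.vecMul_neg, Matrix.vecMul_sum, Finset.sum_eq_zero, neg_zero]
    intro k hk
    rw [Matrix.vecMul_smul, ih _ (by have := Finset.mem_range.1 hk; omega), smul_zero]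

theorem state_shift {E : Matrix (Fin n) (Fin n) K} {B : Matrix (Fin n) κ K} {η : ℕ}
    {x : ℕ → Fin n → K} {μ : ℕ → κ → K} (hx : ∀ j < η, x (j + 1) = E *ᵥ x j + B *ᵥ μ j)
    (k j : ℕ) (h : j + k ≤ η) :
    x (j + k) = (E ^ k) *ᵥ x j + ∑ l ∈ Finset.range k, (E ^ (k - 1 - l) * B) *ᵥ μ (j + l) := by
  induction k with
  | zero => simp
  | succ k ih =>
    rw [← add_assoc, hx _ (by omega), ih (by omega), Matrix.mulVec_add, Matrix.mulVec_mulVec,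
      ← pow_succ', Finset.sum_range_succ, Matrix.mulVec_sum, add_assoc]
    congr 1
    congr 1
    · refine Finset.sum_congr rfl fun l hl => ?_
      have := Finset.mem_range.1 hl
      rw [Matrix.mulVec_mulVec, ← Matrix.mul_assoc, ← pow_succ']
      congr 3
      omega
    · simp

/-- Willems' lemma: if a combination of states and inputs vanishes along data with a persistently
exciting input of order `n + 1`, then its input part is zero and its state part annihilates the
reachable space. -/
theorem willems {E : Matrix (Fin n) (Fin n) K} {B : Matrix (Fin n) κ K} {η : ℕ}
    {x : ℕ → Fin n → K} {μ : ℕ → κ → K} (hx : ∀ j < η, x (j + 1) = E *ᵥ x j + B *ᵥ μ j)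
    (hμ : ∀ c : ℕ → κ → K,
      (∀ j, j + n < η → ∑ l ∈ Finset.range (n + 1), c l ⬝ᵥ μ (j + l) = 0) → ∀ l ≤ n, c l = 0)
    {ζ : Fin n → K} {ρ : κ → K} (h : ∀ j < η, ζ ⬝ᵥ x j + ρ ⬝ᵥ μ j = 0) :
    ρ = 0 ∧ ∀ i, ζ ᵥ* (E ^ i * B) = 0 := by
  classical
  -- Coefficients of the monic characteristic polynomial, with the leading one written as 1.
  set a : ℕ → K := fun k => if k = n then 1 else E.charpoly.coeff k with ha
  have han : a n = 1 := by simp [ha]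
  have hsum : ∑ k ∈ Finset.range (n + 1), a k • E ^ k = 0 := by
    rw [Finset.sum_range_succ, han, one_smul, pow_eq_sum_charpoly E, add_neg_eq_zero]
    refine Finset.sum_congr rfl fun k hk => ?_
    rw [ha]
    simp [(Finset.mem_range.1 hk).ne]
  -- Weight the relation at time j + k by a k and sum over k: Cayley–Hamilton cancels the
  -- contribution of x j, and c l is the coefficient left in front of μ (j + l). Persistency of
  -- excitation then makes every c l vanish.
  set c : ℕ → κ → K := fun l =>
    a l • ρ + ∑ k ∈ Finset.range (n + 1),
      if l < k then a k • (ζ ᵥ* (E ^ (k - 1 - l) * B)) else 0 with hc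
  have hc0 : ∀ l ≤ n, c l = 0 := by
    refine hμ c fun j hj => ?_
    have h0 : ∑ k ∈ Finset.range (n + 1), a k * (ζ ⬝ᵥ x (j + k) + ρ ⬝ᵥ μ (j + k)) = 0 := by
      refine Finset.sum_eq_zero fun k hk => ?_
      rw [h _ (by have := Finset.mem_range.1 hk; omega), mul_zero]
    have h1 : ∑ k ∈ Finset.range (n + 1), a k * (ζ ⬝ᵥ (E ^ k *ᵥ x j)) = 0 := by
      have := congrArg (fun M => ζ ⬝ᵥ (M *ᵥ x j)) hsum
      simpa [Matrix.sum_mulVec, dotProduct_sum, Matrix.smul_mulVec] using this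
    have h2 : ∑ l ∈ Finset.range (n + 1), c l ⬝ᵥ μ (j + l)
        = ∑ k ∈ Finset.range (n + 1), a k * (ρ ⬝ᵥ μ (j + k)) +
          ∑ k ∈ Finset.range (n + 1), a k *
            (ζ ⬝ᵥ ∑ l ∈ Finset.range k, (E ^ (k - 1 - l) * B) *ᵥ μ (j + l)) := by
      simp only [hc, add_dotProduct, sum_dotProduct, Finset.sum_add_distrib, smul_dotProduct,
        smul_eq_mul]
      congr 1
      rw [Finset.sum_comm]
      refine Finset.sum_congr rfl fun k hk => ?_
      have hk' := Finset.mem_range.1 hk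
      rw [dotProduct_sum, Finset.mul_sum]
      have : Finset.range k = (Finset.range (n + 1)).filter (fun l => l < k) := by
        ext l; simp; omega
      rw [this, Finset.sum_filter]
      refine Finset.sum_congr rfl fun l _ => ?_
      split_ifs
      · rw [smul_dotProduct, smul_eq_mul, Matrix.dotProduct_mulVec]
      · simp
    rw [h2]
    rw [← h0, ← sub_eq_zero, ← neg_eq_zero, ← h1, ← Finset.sum_add_distrib,
      ← Finset.sum_sub_distrib, ← Finset.sum_neg_distrib]
    refine Finset.sum_congr rfl fun k hk => ?_
    have hk' := Finset.mem_range.1 hk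
    rw [state_shift hx k j (by omega), dotProduct_add]
    ring
  have hρ : ρ = 0 := by
    have := hc0 n le_rfl
    simp only [hc, han, one_smul] at this
    rwa [Finset.sum_eq_zero, add_zero] at this
    intro k hk
    have hk' := Finset.mem_range.1 hk
    rw [if_neg (by omega)]
  refine ⟨hρ, vecMul_pow_mul_eq_zero E B ζ fun i hi => ?_⟩
  -- In c (n - 1 - i) the term k = n is ζ E^i B; the terms with k < n contain only lower powers of
  -- E, which vanish by induction.
  induction i using Nat.strong_induction_on with
  | _ i ih =>
    have := hc0 (n - 1 - i) (by omega)
    simp only [hc, hρ, smul_zero, zero_add] at this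
    rw [Finset.sum_range_succ, Finset.sum_eq_zero, zero_add, if_pos (by omega), han,
      one_smul] at this
    · rwa [show n - 1 - (n - 1 - i) = i by omega] at this
    · intro k hk
      have hk' := Finset.mem_range.1 hk
      split_ifs
      · rw [ih _ (by omega) (by omega), smul_zero]
      · rfl

end Willems

end NZSGame

namespace NZSGame
open Matrix

/-! ### Matrix exponentials and controllability under sampling. -/

section Sampling

open scoped Matrix.Norms.Operator

variable {n : ℕ}

noncomputable section

/-- The transition matrix `exp (t A)`. -/
def flow (A : Matrix (Fin n) (Fin n) ℂ) (t : ℝ) : Matrix (Fin n) (Fin n) ℂ :=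
  NormedSpace.exp (t • A)

/-- The integral `∫ s in 0..t, exp (s A)`. -/
def flowInt (A : Matrix (Fin n) (Fin n) ℂ) (t : ℝ) : Matrix (Fin n) (Fin n) ℂ :=
  ∫ s in (0 : ℝ)..t, flow A s

end

variable (A : Matrix (Fin n) (Fin n) ℂ)

theorem flow_zero : flow A 0 = 1 := by simp [flow]

theorem hasDerivAt_flow (t : ℝ) : HasDerivAt (flow A) (flow A t * A) t :=
  hasDerivAt_exp_smul_const A t

theorem hasDerivAt_flow' (t : ℝ) : HasDerivAt (flow A) (A * flow A t) t :=
  hasDerivAt_exp_smul_const' A t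

theorem continuous_flow : Continuous (flow A) :=
  continuous_iff_continuousAt.2 fun t => (hasDerivAt_flow A t).continuousAt

theorem commute_flow (t : ℝ) : A * flow A t = flow A t * A :=
  (hasDerivAt_flow' A t).unique (hasDerivAt_flow A t)

theorem flowInt_zero : flowInt A 0 = 0 := by simp [flowInt]

theorem hasDerivAt_flowInt (t : ℝ) : HasDerivAt (flowInt A) (flow A t) t :=
  ((continuous_flow A).integral_hasStrictDerivAt 0 t).hasDerivAt

theorem continuous_flowInt : Continuous (flowInt A) :=
  continuous_iff_continuousAt.2 fun t => (hasDerivAt_flowInt A t).continuousAt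

theorem mul_flowInt (t : ℝ) : A * flowInt A t = flow A t - 1 := by
  have h : ∀ t, HasDerivAt (fun t => A * flowInt A t - flow A t) 0 t := fun t =>
    (((hasDerivAt_flowInt A t).const_mul A).sub (hasDerivAt_flow' A t)).congr_deriv (sub_self _)
  have h1 := is_const_of_deriv_eq_zero (fun t => (h t).differentiableAt) (fun t => (h t).deriv) t 0
  simp only [flowInt_zero, flow_zero, mul_zero, zero_sub] at h1
  rw [sub_eq_iff_eq_add.1 h1]
  abel

theorem flowInt_mul (t : ℝ) : flowInt A t * A = flow A t - 1 := by
  have h : ∀ t, HasDerivAt (fun t => flowInt A t * A - flow A t) 0 t := fun t =>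
    (((hasDerivAt_flowInt A t).mul_const A).sub (hasDerivAt_flow A t)).congr_deriv (sub_self _)
  have h1 := is_const_of_deriv_eq_zero (fun t => (h t).differentiableAt) (fun t => (h t).deriv) t 0
  simp only [flowInt_zero, flow_zero, zero_mul, zero_sub] at h1
  rw [sub_eq_iff_eq_add.1 h1]
  abel

theorem hasDerivAt_linear {M : ℝ → Matrix (Fin n) (Fin n) ℂ} {M' : Matrix (Fin n) (Fin n) ℂ}
    {t : ℝ} (f : Matrix (Fin n) (Fin n) ℂ →ₗ[ℝ] (Fin n → ℂ)) (h : HasDerivAt M M' t) :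
    HasDerivAt (fun t => f (M t)) (f M') t := by
  have h1 := (LinearMap.toContinuousLinearMap f).hasFDerivAt (x := M t)
  exact HasFDerivAt.comp_hasDerivAt (𝕜 := ℝ) t h1 h

theorem hasDerivAt_vecMul {M : ℝ → Matrix (Fin n) (Fin n) ℂ} {M' : Matrix (Fin n) (Fin n) ℂ}
    {t : ℝ} (y : Fin n → ℂ) (h : HasDerivAt M M' t) :
    HasDerivAt (fun t => y ᵥ* M t) (y ᵥ* M') t :=
  hasDerivAt_linear ((Matrix.vecMulBilin ℂ ℂ y).restrictScalars ℝ) h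

theorem hasDerivAt_mulVec {M : ℝ → Matrix (Fin n) (Fin n) ℂ} {M' : Matrix (Fin n) (Fin n) ℂ}
    {t : ℝ} (y : Fin n → ℂ) (h : HasDerivAt M M' t) :
    HasDerivAt (fun t => M t *ᵥ y) (M' *ᵥ y) t :=
  hasDerivAt_linear (((Matrix.mulVecBilin ℂ ℂ).flip y).restrictScalars ℝ) h

/-- Both sides solve y' = y A with the same initial value. A Jordan chain of length two suffices to
detect later that A is not scalar on an eigenspace of the flow. -/
theorem vecMul_flow_of_jordan {y z : Fin n → ℂ} {l : ℂ} (hy : y ᵥ* A = l • y + z)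
    (hz : z ᵥ* A = l • z) (t : ℝ) :
    y ᵥ* flow A t = Complex.exp (l * t) • (y + (t : ℂ) • z) := by
  have hlip : LipschitzWith ‖A.vecMulLinear.toContinuousLinearMap‖₊ (fun y => y ᵥ* A) :=
    A.vecMulLinear.toContinuousLinearMap.lipschitz
  have h := ODE_solution_unique_univ (v := fun _ y => y ᵥ* A) (s := fun _ => Set.univ)
    (K := ‖A.vecMulLinear.toContinuousLinearMap‖₊) (t₀ := 0)
    (f := fun t => y ᵥ* flow A t) (g := fun t => Complex.exp (l * t) • (y + (t : ℂ) • z))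
    (fun _ => hlip.lipschitzOnWith) (fun s => ⟨?_, trivial⟩) (fun s => ⟨?_, trivial⟩)
    (by simp [flow_zero])
  · exact congrFun h t
  · rw [Matrix.vecMul_vecMul]
    exact hasDerivAt_vecMul y (hasDerivAt_flow A s)
  · have h1 : HasDerivAt (fun s : ℝ => (s : ℂ)) 1 s := Complex.ofRealCLM.hasDerivAt
    have h2 := ((h1.const_mul l).cexp).smul ((h1.smul_const z).const_add y)
    refine h2.congr_deriv ?_
    rw [Matrix.smul_vecMul, Matrix.add_vecMul, Matrix.smul_vecMul, hy, hz]
    ext k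
    simp
    ring

theorem vecMul_flow_of_eigen {y : Fin n → ℂ} {l : ℂ} (hy : y ᵥ* A = l • y) (t : ℝ) :
    y ᵥ* flow A t = Complex.exp (l * t) • y := by
  simpa using vecMul_flow_of_jordan A (z := 0) (by simpa using hy) (by simp) t

variable {A} {T : ℝ}

/-- The factor is ∫₀ᵀ exp(ls) ds, that is T for l = 0 and (exp(lT) - 1)/l otherwise; it is nonzero
by the spectral hypothesis. -/
theorem vecMul_flowInt_ne_zero (hT : 0 < T)
    (hA : ∀ z ∈ spectrum ℂ A, z ≠ 0 → Complex.exp (z * T) ≠ 1)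
    {y : Fin n → ℂ} {l : ℂ} (h0 : y ≠ 0) (hy : y ᵥ* A = l • y) :
    ∃ g : ℂ, g ≠ 0 ∧ y ᵥ* flowInt A T = g • y := by
  by_cases hl : l = 0
  · refine ⟨T, by exact_mod_cast hT.ne', ?_⟩
    have h1 : ∀ t, HasDerivAt (fun t => y ᵥ* flowInt A t - (t : ℂ) • y) 0 t := by
      intro t
      have h1 : HasDerivAt (fun s : ℝ => (s : ℂ)) 1 t := Complex.ofRealCLM.hasDerivAt
      refine ((hasDerivAt_vecMul y (hasDerivAt_flowInt A t)).sub (h1.smul_const y)).congr_deriv ?_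
      rw [vecMul_flow_of_eigen A hy, hl]
      simp
    have h2 := is_const_of_deriv_eq_zero (fun t => (h1 t).differentiableAt)
      (fun t => (h1 t).deriv) T 0
    simpa [flowInt_zero, sub_eq_zero] using h2
  · refine ⟨(Complex.exp (l * T) - 1) / l,
      div_ne_zero (sub_ne_zero.2 (hA l (mem_spectrum_of_vecMul h0 hy) hl)) hl, ?_⟩
    have h1 := congrArg (fun M => y ᵥ* M) (mul_flowInt A T)
    simp only [← Matrix.vecMul_vecMul, hy, Matrix.smul_vecMul, Matrix.vecMul_sub,
      vecMul_flow_of_eigen A hy, Matrix.vecMul_one] at h1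
    rw [div_eq_inv_mul, mul_smul, sub_smul, one_smul, ← h1, smul_smul, inv_mul_cancel₀ hl,
      one_smul]

/-- Since `flowInt A T` commutes with A, its left kernel is A-invariant; a nonzero kernel would
contain an eigenvector of A, on which the integral acts by a nonzero scalar. -/
theorem flowInt_injective (hT : 0 < T)
    (hA : ∀ z ∈ spectrum ℂ A, z ≠ 0 → Complex.exp (z * T) ≠ 1)
    {y : Fin n → ℂ} (hy : y ᵥ* flowInt A T = 0) : y = 0 := by
  by_contra hne
  obtain ⟨l, w, hw, hw0, hwl⟩ := exists_left_eigenvector_mem A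
    (LinearMap.ker (flowInt A T).vecMulLinear) (fun v hv => by
      have hv : v ᵥ* flowInt A T = 0 := hv
      change v ᵥ* A ᵥ* flowInt A T = 0
      rw [Matrix.vecMul_vecMul, mul_flowInt, ← flowInt_mul, ← Matrix.vecMul_vecMul, hv,
        Matrix.zero_vecMul])
    ((Submodule.ne_bot_iff _).2 ⟨y, hy, hne⟩)
  obtain ⟨g, hg, h⟩ := vecMul_flowInt_ne_zero hT hA hw0 hwl
  rw [show w ᵥ* flowInt A T = 0 from hw] at h
  exact (smul_ne_zero hg hw0) h.symm

/-- On the eigenspaces of `exp (T A)` the matrix `A` acts as a scalar, if `z ↦ exp (T z)` is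
injective on the spectrum of `A`. -/
theorem eigenvector_of_flow (hT : 0 < T)
    (hA : ∀ z ∈ spectrum ℂ A, ∀ w ∈ spectrum ℂ A, Complex.exp (z * T) = Complex.exp (w * T) →
      z = w)
    {y : Fin n → ℂ} {θ : ℂ} (h0 : y ≠ 0) (hy : y ᵥ* flow A T = θ • y) :
    ∃ l : ℂ, y ᵥ* A = l • y := by
  let Y : Submodule ℂ (Fin n → ℂ) :=
    LinearMap.ker ((flow A T).vecMulLinear - θ • LinearMap.id)
  have hY : ∀ v, v ∈ Y ↔ v ᵥ* flow A T = θ • v := fun v => by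
    simp [Y, LinearMap.mem_ker, sub_eq_zero]
  have hYA : ∀ v ∈ Y, v ᵥ* A ∈ Y := fun v hv => by
    rw [hY] at hv ⊢
    rw [Matrix.vecMul_vecMul, commute_flow, ← Matrix.vecMul_vecMul, hv, Matrix.smul_vecMul]
  obtain ⟨l, w, hw, hw0, hwl⟩ := exists_left_eigenvector_mem A Y hYA
    ((Submodule.ne_bot_iff _).2 ⟨y, (hY y).2 hy, h0⟩)
  have hθ : ∀ {l' : ℂ} {w' : Fin n → ℂ}, w' ∈ Y → w' ≠ 0 → w' ᵥ* A = l' • w' →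
      Complex.exp (l' * T) = θ := by
    intro l' w' h1 h2 h3
    have := (vecMul_flow_of_eigen A h3 T).symm.trans ((hY w').1 h1)
    exact smul_left_injective ℂ h2 this
  refine ⟨l, ?_⟩
  -- On Y the only eigenvalue of A is l, by injectivity of the exponential. If A - l were nonzero on
  -- Y, its image would contain an eigenvector f v, and v would head a Jordan chain; the flow would
  -- then add a multiple of T • f v to v, contradicting that v is an eigenvector of the flow.
  let f : (Fin n → ℂ) →ₗ[ℂ] (Fin n → ℂ) := A.vecMulLinear - l • LinearMap.id
  have hf : ∀ v, f v = v ᵥ* A - l • v := fun v => by simp [f]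
  by_contra hne
  obtain ⟨l', w', ⟨v, hv, rfl⟩, hw0', hwl'⟩ := exists_left_eigenvector_mem A (Y.map f) (by
      rintro _ ⟨v, hv, rfl⟩
      exact ⟨v ᵥ* A, hYA v hv, by simp [hf, Matrix.sub_vecMul, Matrix.smul_vecMul]⟩)
    ((Submodule.ne_bot_iff _).2 ⟨f y, ⟨y, (hY y).2 hy, rfl⟩, by
      rw [hf]; exact sub_ne_zero.2 hne⟩)
  have hfv : f v ∈ Y := by
    rw [hf]; exact Y.sub_mem (hYA v hv) (Y.smul_mem _ hv)
  have hl : l' = l := hA _ (mem_spectrum_of_vecMul hw0' hwl') _ (mem_spectrum_of_vecMul hw0 hwl)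
    ((hθ hfv hw0' hwl').trans (hθ hw hw0 hwl).symm)
  rw [hl] at hwl'
  have h1 := vecMul_flow_of_jordan A (y := v) (z := f v) (l := l) (by rw [hf]; simp) hwl' T
  rw [(hY v).1 hv, hθ hw hw0 hwl] at h1
  have hθ0 : θ ≠ 0 := by
    rw [← hθ hw hw0 hwl]; exact Complex.exp_ne_zero _
  have h2 := smul_right_injective _ hθ0 h1
  have h3 : (T : ℂ) • f v = 0 := by simpa using h2.symm
  exact (smul_ne_zero (by exact_mod_cast hT.ne') hw0') h3

/-- Controllability is preserved under sampling. -/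
theorem sampled_controllable {κ : Type*} {B : Matrix (Fin n) κ ℂ} (hT : 0 < T)
    (hA1 : ∀ z ∈ spectrum ℂ A, z ≠ 0 → Complex.exp (z * T) ≠ 1)
    (hA : ∀ z ∈ spectrum ℂ A, ∀ w ∈ spectrum ℂ A, Complex.exp (z * T) = Complex.exp (w * T) →
      z = w)
    (hB : ∀ v : Fin n → ℂ, (∀ i < n, v ᵥ* (A ^ i * B) = 0) → v = 0)
    {v : Fin n → ℂ} (hv : ∀ i, v ᵥ* (flow A T ^ i * (flowInt A T * B)) = 0) : v = 0 := by
  by_contra hne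
  let Y : Submodule ℂ (Fin n → ℂ) :=
    ⨅ i : ℕ, LinearMap.ker (flow A T ^ i * (flowInt A T * B)).vecMulLinear
  have hY : ∀ w, w ∈ Y ↔ ∀ i, w ᵥ* (flow A T ^ i * (flowInt A T * B)) = 0 := fun w => by
    simp [Y, Submodule.mem_iInf, LinearMap.mem_ker]
  obtain ⟨θ, w, hw, hw0, hwθ⟩ := exists_left_eigenvector_mem (flow A T) Y (fun w hw => by
      rw [hY] at hw ⊢
      intro i
      rw [Matrix.vecMul_vecMul, ← Matrix.mul_assoc, ← pow_succ']
      exact hw (i + 1))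
    ((Submodule.ne_bot_iff _).2 ⟨v, (hY v).2 hv, hne⟩)
  -- The eigenvector w of the flow is one of A, and G acts on it by g ≠ 0. Hence w annihilates B
  -- itself, and with it every A^i B.
  obtain ⟨l, hl⟩ := eigenvector_of_flow hT hA hw0 hwθ
  obtain ⟨g, hg, hgw⟩ := vecMul_flowInt_ne_zero hT hA1 hw0 hl
  have h1 := (hY w).1 hw 0
  rw [pow_zero, Matrix.one_mul, ← Matrix.vecMul_vecMul, hgw, Matrix.smul_vecMul] at h1
  have h2 : w ᵥ* B = 0 := (smul_eq_zero.1 h1).resolve_left hg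
  have h3 : ∀ i, w ᵥ* A ^ i = l ^ i • w := by
    intro i
    induction i with
    | zero => simp
    | succ i ih => rw [pow_succ, ← Matrix.vecMul_vecMul, ih, Matrix.smul_vecMul, hl, smul_smul,
        pow_succ]
  refine hw0 (hB w fun i _ => ?_)
  rw [← Matrix.vecMul_vecMul, h3, Matrix.smul_vecMul, h2, smul_zero]

end Sampling

/-! ### Non-pathological sampling times in terms of exponentials. -/

section Nonpathological

variable {n : ℕ} {A : Matrix (Fin n) (Fin n) ℝ} {T : ℝ}

theorem IsNonpathological.exp_injective (h : IsNonpathological A T) (hT : 0 < T) {z w : ℂ}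
    (hz : z ∈ spectrum ℂ (A.map (fun a : ℝ => (a : ℂ))))
    (hw : w ∈ spectrum ℂ (A.map (fun a : ℝ => (a : ℂ))))
    (hzw : Complex.exp (z * T) = Complex.exp (w * T)) : z = w := by
  by_contra hne
  obtain ⟨k, hk⟩ := Complex.exp_eq_exp_iff_exists_int.1 hzw
  have h1 := congrArg Complex.re hk
  have h2 := congrArg Complex.im hk
  simp at h1 h2
  refine h z hz w hw hne (h1.resolve_right hT.ne') k ?_
  rw [eq_div_iff hT.ne']
  linarith

theorem IsNonpathological.exp_ne_one (h : IsNonpathological A T) (hT : 0 < T) {z : ℂ}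
    (hz : z ∈ spectrum ℂ (A.map (fun a : ℝ => (a : ℂ)))) (hz0 : z ≠ 0) :
    Complex.exp (z * T) ≠ 1 := by
  intro h1
  -- The conjugate of z is an eigenvalue with the same exponential value 1, so z is real; a real
  -- exponential equals 1 only at 0.
  have h2 : z = (starRingEnd ℂ) z := by
    refine h.exp_injective hT hz (conj_mem_spectrum hz) ?_
    have := congrArg (starRingEnd ℂ) h1
    rw [← Complex.exp_conj, map_mul, Complex.conj_ofReal, map_one] at this
    rw [h1, this]
  have h3 : z = (z.re : ℂ) := (Complex.conj_eq_iff_re.1 h2.symm).symm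
  rw [h3, ← Complex.ofReal_mul, ← Complex.ofReal_exp, ← Complex.ofReal_one,
    Complex.ofReal_inj, Real.exp_eq_one_iff] at h1
  rcases mul_eq_zero.1 h1 with h4 | h4
  · exact hz0 (by rw [h3, h4]; simp)
  · exact hT.ne' h4

end Nonpathological
end NZSGame

namespace NZSGame
open Matrix

/-! ### Explicit solution on one interval of constant input. -/

section LocalSolution

open scoped Matrix.Norms.Operator

variable {n : ℕ}

/-- The double integral `∫ s in 0..t, ∫ r in 0..s, exp (r A)`. -/
noncomputable def flowIntInt (A : Matrix (Fin n) (Fin n) ℂ) (t : ℝ) : Matrix (Fin n) (Fin n) ℂ :=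
  ∫ s in (0 : ℝ)..t, flowInt A s

theorem hasDerivAt_flowIntInt (A : Matrix (Fin n) (Fin n) ℂ) (t : ℝ) :
    HasDerivAt (flowIntInt A) (flowInt A t) t :=
  ((continuous_flowInt A).integral_hasStrictDerivAt 0 t).hasDerivAt

theorem flowIntInt_zero (A : Matrix (Fin n) (Fin n) ℂ) : flowIntInt A 0 = 0 := by
  simp [flowIntInt]

/-- The integrand is extended constantly beyond [0, T], so that the solution gets two-sided
derivatives at the endpoints as well. -/
theorem exists_hasDerivAt_of_integral_eq {y g : ℝ → Fin n → ℝ} {T : ℝ} (hT : 0 < T)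
    (hg : ContinuousOn g (Set.Icc 0 T))
    (h : ∀ t ∈ Set.Icc 0 T, y t = y 0 + ∫ s in (0 : ℝ)..t, g s) :
    ∃ z : ℝ → Fin n → ℝ, Set.EqOn z y (Set.Icc 0 T) ∧ ContinuousOn z (Set.Icc 0 T) ∧
      ∀ t ∈ Set.Icc 0 T, HasDerivAt z (g t) t := by
  let g' : ℝ → Fin n → ℝ := Set.IccExtend hT.le ((Set.Icc 0 T).domRestrict g)
  have hg' : Continuous g' := (continuousOn_iff_continuous_domRestrict.1 hg).Icc_extend'
  have hgg : Set.EqOn g' g (Set.Icc 0 T) := fun t ht => by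
    simp [g', Set.IccExtend_of_mem hT.le _ ht, Set.domRestrict_apply]
  have hd : ∀ t, HasDerivAt (fun t => y 0 + ∫ s in (0 : ℝ)..t, g' s) (g' t) t := fun t =>
    ((hg'.integral_hasStrictDerivAt 0 t).hasDerivAt).const_add (y 0)
  refine ⟨fun t => y 0 + ∫ s in (0 : ℝ)..t, g' s, fun t ht => ?_,
    fun t _ => (hd t).continuousAt.continuousWithinAt, fun t ht => ?_⟩
  · dsimp only
    rw [h t ht]
    congr 1
    refine intervalIntegral.integral_congr fun s hs => hgg ?_
    rw [Set.uIcc_of_le ht.1] at hs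
    exact ⟨hs.1, hs.2.trans ht.2⟩
  · rw [← hgg ht]
    exact hd t

variable {A : Matrix (Fin n) (Fin n) ℝ} {b : Fin n → ℝ} {y : ℝ → Fin n → ℝ} {T : ℝ}

theorem increment_eq (hT : 0 < T) (hy : ContinuousOn y (Set.Icc 0 T))
    (h : ∀ t ∈ Set.Icc 0 T, y t = y 0 + ∫ s in (0 : ℝ)..t, (A *ᵥ y s + b)) :
    y T - y 0 = A *ᵥ (fun a => ∫ s in (0 : ℝ)..T, y s a) + T • b := by
  have hg : ContinuousOn (fun s => A *ᵥ y s + b) (Set.Icc 0 T) :=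
    (A.mulVecLin.toContinuousLinearMap.continuous.comp_continuousOn hy).add continuousOn_const
  obtain ⟨z, hz, hzc, hzd⟩ := exists_hasDerivAt_of_integral_eq hT hg h
  have hyc : ∀ k, ContinuousOn (fun s => y s k) (Set.Icc 0 T) := fun k =>
    (continuous_apply k).comp_continuousOn hy
  have hyi : ∀ k, IntervalIntegrable (fun s => y s k) MeasureTheory.volume 0 T := fun k =>
    ContinuousOn.intervalIntegrable (by rw [Set.uIcc_of_le hT.le]; exact hyc k)
  ext a
  have h1 := intervalIntegral.integral_eq_sub_of_hasDerivAt (a := 0) (b := T)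
    (f := fun t => z t a) (f' := fun t => (A *ᵥ y t + b) a) (fun t ht => by
      rw [Set.uIcc_of_le hT.le] at ht
      exact hasDerivAt_pi.1 (hzd t ht) a)
    (ContinuousOn.intervalIntegrable (by
      rw [Set.uIcc_of_le hT.le]; exact (continuous_apply a).comp_continuousOn hg))
  rw [hz ⟨hT.le, le_rfl⟩, hz ⟨le_rfl, hT.le⟩] at h1
  rw [Pi.sub_apply, ← h1]
  simp only [Pi.add_apply, Matrix.mulVec, dotProduct, Pi.smul_apply, smul_eq_mul]
  rw [intervalIntegral.integral_add _ (by simp), intervalIntegral.integral_finsetSum]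
  · simp
  · exact fun k _ => (hyi k).const_mul _
  · simpa only [Finset.sum_fn] using
      IntervalIntegrable.sum Finset.univ fun k _ => (hyi k).const_mul (A a k)

theorem complex_solution (hT : 0 < T) (hy : ContinuousOn y (Set.Icc 0 T))
    (h : ∀ t ∈ Set.Icc 0 T, y t = y 0 + ∫ s in (0 : ℝ)..t, (A *ᵥ y s + b)) :
    ∀ t ∈ Set.Icc 0 T, (fun a => (y t a : ℂ))
      = flow (A.map (fun a : ℝ => (a : ℂ))) t *ᵥ (fun a => (y 0 a : ℂ))
        + flowInt (A.map (fun a : ℝ => (a : ℂ))) t *ᵥ (fun a => (b a : ℂ)) := by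
  set AC := A.map (fun a : ℝ => (a : ℂ)) with hAC
  have hg : ContinuousOn (fun s => A *ᵥ y s + b) (Set.Icc 0 T) :=
    (A.mulVecLin.toContinuousLinearMap.continuous.comp_continuousOn hy).add continuousOn_const
  obtain ⟨z, hz, hzc, hzd⟩ := exists_hasDerivAt_of_integral_eq hT hg h
  have hlip : LipschitzWith ‖AC.mulVecLin.toContinuousLinearMap‖₊
      (fun v => AC *ᵥ v + (fun a => (b a : ℂ))) := by
    have := AC.mulVecLin.toContinuousLinearMap.lipschitz
    intro v w
    simpa using this v w
  have key := ODE_solution_unique_of_mem_Icc_right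
    (v := fun _ v => AC *ᵥ v + (fun a => (b a : ℂ))) (s := fun _ => Set.univ) (a := 0) (b := T)
    (f := fun t a => (z t a : ℂ)) (g := fun t => flow AC t *ᵥ (fun a => (y 0 a : ℂ))
        + flowInt AC t *ᵥ (fun a => (b a : ℂ)))
    (fun _ _ => hlip.lipschitzOnWith) ?_ ?_ (fun _ _ => trivial) ?_ ?_ (fun _ _ => trivial) ?_
  · intro t ht
    refine Eq.trans ?_ (key ht)
    simp only [hz ht]
  · exact continuousOn_pi.2 fun a =>
      Complex.continuous_ofReal.comp_continuousOn (continuousOn_pi.1 hzc a)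
  · intro t ht
    have ht' := Set.Ico_subset_Icc_self ht
    refine HasDerivAt.hasDerivWithinAt (hasDerivAt_pi.2 fun a => ?_)
    refine ((hasDerivAt_pi.1 (hzd t ht') a).ofReal_comp).congr_deriv ?_
    simp [hz ht', hAC, Matrix.mulVec, dotProduct]
  · intro t _
    exact ((hasDerivAt_mulVec _ (hasDerivAt_flow AC t)).add
      (hasDerivAt_mulVec _ (hasDerivAt_flowInt AC t))).continuousAt.continuousWithinAt
  · intro t _
    refine HasDerivAt.hasDerivWithinAt (((hasDerivAt_mulVec _ (hasDerivAt_flow' AC t)).add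
      (hasDerivAt_mulVec _ (hasDerivAt_flowInt AC t))).congr_deriv ?_)
    rw [Matrix.mulVec_add, Matrix.mulVec_mulVec, Matrix.mulVec_mulVec, mul_flowInt,
      Matrix.sub_mulVec, Matrix.one_mulVec, add_assoc, sub_add_cancel]
  · simp [flow_zero, flowInt_zero, hz (Set.left_mem_Icc.2 hT.le)]

theorem complex_integral (hT : 0 < T) (hy : ContinuousOn y (Set.Icc 0 T))
    (h : ∀ t ∈ Set.Icc 0 T, y t = y 0 + ∫ s in (0 : ℝ)..t, (A *ᵥ y s + b)) :
    (fun a => ((∫ s in (0 : ℝ)..T, y s a : ℝ) : ℂ))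
      = flowInt (A.map (fun a : ℝ => (a : ℂ))) T *ᵥ (fun a => (y 0 a : ℂ))
        + flowIntInt (A.map (fun a : ℝ => (a : ℂ))) T *ᵥ (fun a => (b a : ℂ)) := by
  set AC := A.map (fun a : ℝ => (a : ℂ)) with hAC
  have hs := complex_solution hT hy h
  ext a
  have hd : ∀ t ∈ Set.Icc 0 T, HasDerivAt (fun t => flowInt AC t *ᵥ (fun a => (y 0 a : ℂ))
      + flowIntInt AC t *ᵥ (fun a => (b a : ℂ))) (fun a => (y t a : ℂ)) t := fun t ht => by
    rw [hs t ht]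
    exact (hasDerivAt_mulVec _ (hasDerivAt_flowInt AC t)).add
      (hasDerivAt_mulVec _ (hasDerivAt_flowIntInt AC t))
  rw [← intervalIntegral.integral_ofReal]
  rw [intervalIntegral.integral_eq_sub_of_hasDerivAt (f' := fun t => (y t a : ℂ)) (fun t ht => by
    rw [Set.uIcc_of_le hT.le] at ht
    exact hasDerivAt_pi.1 (hd t ht) a)]
  · simp [flowInt_zero, flowIntInt_zero]
  · refine ContinuousOn.intervalIntegrable ?_
    rw [Set.uIcc_of_le hT.le]
    exact Complex.continuous_ofReal.comp_continuousOn (continuousOn_pi.1 hy a)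

end LocalSolution

/-! ### The measured data: dynamics and full row rank. -/

section Data

variable {n N : ℕ} {m : Fin N → ℕ} {A : Matrix (Fin n) (Fin n) ℝ}
  {B : ∀ i, Matrix (Fin n) (Fin (m i)) ℝ} {η : ℕ} {T : ℝ}
  {x : ℝ → Fin n → ℝ} {u : ∀ i, ℝ → Fin (m i) → ℝ} {μ : ℕ → (Σ i, Fin (m i)) → ℝ}

theorem stackCols_mulVec (B : ∀ i, Matrix (Fin n) (Fin (m i)) ℝ) (v : (Σ i, Fin (m i)) → ℝ) :
    stackCols B *ᵥ v = ∑ i, B i *ᵥ fun a => v ⟨i, a⟩ := by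
  ext r
  simp [Matrix.mulVec, dotProduct, stackCols, Fintype.sum_sigma]

theorem IsTrajectory.on_interval (hT : 0 < T) (hxu : IsTrajectory A B (η * T) x u)
    (hμ : ∀ j < η, ∀ t, 0 ≤ t → t < T → ∀ p : Σ i, Fin (m i), u p.1 (t + j * T) p.2 = μ j p)
    {j : ℕ} (hj : j < η) :
    ContinuousOn (fun t => x (t + j * T)) (Set.Icc 0 T) ∧
    ∀ t ∈ Set.Icc 0 T, x (t + j * T) = x (0 + j * T) +
      ∫ s in (0 : ℝ)..t, (A *ᵥ x (s + j * T) + stackCols B *ᵥ μ j) := by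
  obtain ⟨hx, hu, hint⟩ := hxu
  have hjT : (0 : ℝ) ≤ j * T := by positivity
  have hjη : (j : ℝ) * T + T ≤ η * T := by
    have : (j : ℝ) + 1 ≤ η := by exact_mod_cast hj
    nlinarith
  have hmem : ∀ t ∈ Set.Icc 0 T, t + j * T ∈ Set.Icc 0 (η * T) := fun t ht =>
    ⟨by linarith [ht.1], by linarith [ht.2]⟩
  refine ⟨hx.comp (by fun_prop) hmem, fun t ht => ?_⟩
  have hI : IntervalIntegrable (fun s => A *ᵥ x s + ∑ i, B i *ᵥ u i s) MeasureTheory.volume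
      0 (η * T) := by
    have h1 : ∀ i ∈ Finset.univ, IntervalIntegrable (fun s => B i *ᵥ u i s) MeasureTheory.volume
        0 (η * T) := fun i _ =>
      ⟨(B i).mulVecLin.toContinuousLinearMap.integrable_comp (hu i).1,
        (B i).mulVecLin.toContinuousLinearMap.integrable_comp (hu i).2⟩
    have h2 := IntervalIntegrable.sum Finset.univ h1
    have h3 : (fun s => ∑ i, B i *ᵥ u i s) = ∑ i, fun s => B i *ᵥ u i s := by
      ext s : 1
      rw [Finset.sum_apply]
    rw [← h3] at h2
    refine IntervalIntegrable.add (ContinuousOn.intervalIntegrable ?_) h2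
    rw [Set.uIcc_of_le (by linarith)]
    exact A.mulVecLin.toContinuousLinearMap.continuous.comp_continuousOn hx
  have hsub : ∀ s ∈ Set.Icc (0 : ℝ) (η * T), Set.uIcc 0 s ⊆ Set.uIcc 0 (η * T) := fun s hs => by
    rw [Set.uIcc_of_le hs.1, Set.uIcc_of_le (by linarith)]
    exact Set.Icc_subset_Icc_right hs.2
  have h0 := hmem 0 ⟨le_rfl, hT.le⟩
  rw [hint _ (hmem t ht), hint _ h0, add_assoc]
  congr 1
  rw [← intervalIntegral.integral_add_adjacent_intervals (hI.mono_set (hsub _ h0))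
    ((hI.mono_set (hsub _ h0)).symm.trans (hI.mono_set (hsub _ (hmem t ht))))]
  congr 1
  rw [← intervalIntegral.integral_comp_add_right (fun s => A *ᵥ x s + ∑ i, B i *ᵥ u i s)]
  -- Equality on the open interval is enough; at the right end of the sampling interval the input is
  -- not prescribed by μ j.
  refine intervalIntegral.integral_congr_uIoo fun s hs => ?_
  rw [Set.uIoo_of_le ht.1] at hs
  simp only [stackCols_mulVec]
  congr 1
  refine Finset.sum_congr rfl fun i _ => ?_
  congr 1
  ext a
  exact hμ j hj s hs.1.le (hs.2.trans_le ht.2) ⟨i, a⟩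

theorem collect_U (hT : 0 < T)
    (hμ : ∀ j < η, ∀ t, 0 ≤ t → t < T → ∀ p : Σ i, Fin (m i), u p.1 (t + j * T) p.2 = μ j p)
    (i : Fin N) (a : Fin (m i)) (c : Fin η) :
    (collect η T x u).U i a c = T * μ c ⟨i, a⟩ := by
  change ∫ t in (0 : ℝ)..T, u i (t + (c : ℕ) * T) a = _
  rw [intervalIntegral.integral_congr_uIoo (g := fun _ => μ c ⟨i, a⟩)]
  · simp
  · intro s hs
    rw [Set.uIoo_of_le hT.le] at hs
    exact hμ c c.2 s hs.1.le hs.2 ⟨i, a⟩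

/-- The dynamics in terms of the data matrices. -/
theorem collect_Xd (hT : 0 < T) (hxu : IsTrajectory A B (η * T) x u)
    (hμ : ∀ j < η, ∀ t, 0 ≤ t → t < T → ∀ p : Σ i, Fin (m i), u p.1 (t + j * T) p.2 = μ j p) :
    (collect η T x u).Xd = A * (collect η T x u).X
      + stackCols B * stackRows (collect η T x u).U := by
  ext a c
  obtain ⟨h1, h2⟩ := hxu.on_interval hT hμ c.2
  have h := congrFun (increment_eq hT h1 h2) a
  refine Eq.trans h ?_
  rw [Matrix.add_apply, Pi.add_apply, ← Matrix.mulVec_smul]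
  congr 1
  refine Finset.sum_congr rfl fun p _ => ?_
  congr 1
  exact (collect_U (x := x) hT hμ p.1 p.2 c).symm

/-- The stacked integrals of states and inputs have full row rank. -/
theorem collect_left_kernel (hAB : IsControllable A (stackCols B)) (hT : 0 < T)
    (hxu : IsTrajectory A B (η * T) x u) (hu : IsPCPE A η T (n + 1) u)
    {ξ : Fin n → ℝ} {ν : (Σ i, Fin (m i)) → ℝ}
    (h : ξ ᵥ* (collect η T x u).X + ν ᵥ* stackRows (collect η T x u).U = 0) :
    ξ = 0 ∧ ν = 0 := by
  obtain ⟨μ, hμ, hrank, hnp⟩ := hu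
  set AC := A.map (fun a : ℝ => (a : ℂ)) with hAC
  set BC := (stackCols B).map (fun a : ℝ => (a : ℂ)) with hBC
  set G := flowInt AC T with hG
  set W := flowIntInt AC T with hW
  let xc : ℕ → Fin n → ℂ := fun j a => (x (j * T) a : ℂ)
  let μc : ℕ → (Σ i, Fin (m i)) → ℂ := fun j p => (μ j p : ℂ)
  let ξc : Fin n → ℂ := fun a => (ξ a : ℂ)
  let νc : (Σ i, Fin (m i)) → ℂ := fun a => (ν a : ℂ)
  have hb : ∀ j, (fun a => (((stackCols B *ᵥ μ j) a : ℝ) : ℂ)) = BC *ᵥ μc j := fun j => by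
    ext a; simp [hBC, Matrix.mulVec, dotProduct, μc]
  have hx : ∀ j < η, xc (j + 1) = flow AC T *ᵥ xc j + (G * BC) *ᵥ μc j := fun j hj => by
    obtain ⟨h1, h2⟩ := hxu.on_interval hT hμ hj
    have h3 := complex_solution hT h1 h2 T ⟨hT.le, le_rfl⟩
    rw [hb, Matrix.mulVec_mulVec] at h3
    simp only [zero_add] at h3
    refine Eq.trans ?_ h3
    ext a
    simp only [xc]
    congr 3
    push_cast
    ring
  have hX : ∀ c : Fin η, (fun a => ((collect η T x u).X a c : ℂ))
      = G *ᵥ xc c + (W * BC) *ᵥ μc c := fun c => by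
    obtain ⟨h1, h2⟩ := hxu.on_interval hT hμ c.2
    have h3 := complex_integral hT h1 h2
    rw [hb, Matrix.mulVec_mulVec] at h3
    simp only [zero_add] at h3
    exact h3
  have hpe : ∀ c : ℕ → (Σ i, Fin (m i)) → ℂ,
      (∀ j, j + n < η → ∑ l ∈ Finset.range (n + 1), c l ⬝ᵥ μc (j + l) = 0) →
        ∀ l ≤ n, c l = 0 := by
    intro c hc l hl
    have hz : (fun p : Fin (n + 1) × (Σ i, Fin (m i)) => c p.1 p.2) = 0 := by
      refine complex_vecMul_eq_zero (M := blockHankel η (n + 1) μ)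
        (fun v => vecMul_eq_zero_of_rank_eq_card ?_) ?_
      · rw [hrank]; simp [mul_comm]
      · ext j
        have := hc j (by have := j.2; omega)
        rw [Finset.sum_range] at this
        simpa [Matrix.vecMul, dotProduct, Fintype.sum_prod_type, blockHankel, μc, add_comm]
          using this
    ext p
    exact congrFun hz (⟨l, by omega⟩, p)
  -- Column j of X is G x_j + W B μ_j and column j of U is T μ_j, so the left null vector becomes a
  -- relation between sampled states and inputs.
  have hann : ∀ j < η, (ξc ᵥ* G) ⬝ᵥ xc j + (ξc ᵥ* (W * BC) + (T : ℂ) • νc) ⬝ᵥ μc j = 0 := by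
    intro j hj
    have h1 := congrFun h ⟨j, hj⟩
    have h2 : ξc ⬝ᵥ (fun a => ((collect η T x u).X a ⟨j, hj⟩ : ℂ))
        + νc ⬝ᵥ ((T : ℂ) • μc j) = 0 := by
      have h3 := congrArg (fun r : ℝ => (r : ℂ)) h1
      simp only [Pi.add_apply, Matrix.vecMul, dotProduct, stackRows, Matrix.of_apply,
        collect_U hT hμ] at h3
      simpa [dotProduct, ξc, νc, μc] using h3
    rw [hX] at h2
    rw [← h2, dotProduct_add, add_dotProduct, Matrix.dotProduct_mulVec, Matrix.dotProduct_mulVec,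
      smul_dotProduct, dotProduct_smul]
    ring
  obtain ⟨hρ, hζ⟩ := willems hx hpe hann
  have hne : ∀ z ∈ spectrum ℂ AC, z ≠ 0 → Complex.exp (z * T) ≠ 1 := fun z hz h0 =>
    hnp.exp_ne_one hT hz h0
  have hctr : ∀ v : Fin n → ℂ, (∀ i < n, v ᵥ* (AC ^ i * BC) = 0) → v = 0 := by
    intro v hv
    refine complex_vecMul_eq_zero (fun w => vecMul_eq_zero_of_rank_eq_card
      (hAB.trans (Fintype.card_fin n).symm)) ?_
    ext p
    have := congrFun (hv p.1 p.1.2) p.2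
    have hpow : AC ^ (p.1 : ℕ) * BC = (A ^ (p.1 : ℕ) * stackCols B).map (fun a : ℝ => (a : ℂ)) := by
      have h1 := Matrix.map_mul (L := A ^ (p.1 : ℕ)) (M := stackCols B) (f := Complex.ofRealHom)
      have h2 := Matrix.map_pow A Complex.ofRealHom (p.1 : ℕ)
      exact (h1.trans (by rw [h2]; rfl)).symm
    rw [hpow] at this
    exact this
  have h0 := sampled_controllable hT hne (fun z hz w hw => hnp.exp_injective hT hz hw) hctr hζ
  have hξc : ξc = 0 := flowInt_injective hT hne h0
  have hνc : νc = 0 := by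
    rw [hξc, Matrix.zero_vecMul, zero_add] at hρ
    exact (smul_eq_zero.1 hρ).resolve_left (by exact_mod_cast hT.ne')
  exact ⟨funext fun a => Complex.ofReal_eq_zero.1 (congrFun hξc a),
    funext fun a => Complex.ofReal_eq_zero.1 (congrFun hνc a)⟩

theorem collect_exists_solution (hAB : IsControllable A (stackCols B)) (hT : 0 < T)
    (hxu : IsTrajectory A B (η * T) x u) (hu : IsPCPE A η T (n + 1) u) {k : ℕ}
    (Y : Matrix (Fin n) (Fin k) ℝ) (V : ∀ i, Matrix (Fin (m i)) (Fin k) ℝ) :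
    ∃ Γ : Matrix (Fin η) (Fin k) ℝ, (collect η T x u).X * Γ = Y ∧
      ∀ i, (collect η T x u).U i * Γ = V i := by
  set d := collect η T x u with hd
  let D : Matrix (Fin n ⊕ (Σ i, Fin (m i))) (Fin η) ℝ := Matrix.fromRows d.X (stackRows d.U)
  obtain ⟨Z, hZ⟩ := exists_mul_eq_one_of_left_kernel (M := D) fun v hv => by
    rw [← Sum.elim_comp_inl_inr v, Matrix.vecMul_fromRows, Sum.elim_comp_inl,
      Sum.elim_comp_inr] at hv
    obtain ⟨h1, h2⟩ := collect_left_kernel hAB hT hxu hu hv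
    ext (a | a)
    · exact congrFun h1 a
    · exact congrFun h2 a
  have h : D * (Z * Matrix.fromRows Y (stackRows V)) = Matrix.fromRows Y (stackRows V) := by
    rw [← Matrix.mul_assoc, hZ, Matrix.one_mul]
  refine ⟨Z * Matrix.fromRows Y (stackRows V), ?_, fun i => ?_⟩
  · ext a c
    exact congrFun (congrFun h (Sum.inl a)) c
  · ext a c
    exact congrFun (congrFun h (Sum.inr ⟨i, a⟩)) c

end Data
end NZSGame

namespace NZSGame
open Matrix

/-! ### Lyapunov equations and stability from a Riccati equation. -/

section Hurwitz

variable {n : ℕ}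

/-- The Lyapunov equation of a Hurwitz matrix has at most one solution. -/
theorem lyapunov_unique {F P P' Q : Matrix (Fin n) (Fin n) ℝ} (hF : IsHurwitz F)
    (h : P * F + Fᵀ * P = Q) (h' : P' * F + Fᵀ * P' = Q) : P = P' := by
  let M : Matrix (Fin n) (Fin n) ℂ := F.map (fun a : ℝ => (a : ℂ))
  let L : Matrix (Fin n) (Fin n) ℂ →ₗ[ℂ] Matrix (Fin n) (Fin n) ℂ :=
    LinearMap.mulRight ℂ M + LinearMap.mulLeft ℂ Mᵀ
  have hL : ∀ Z, Z ∈ LinearMap.ker L ↔ Z * M + Mᵀ * Z = 0 := fun Z => by simp [L]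
  have hker : LinearMap.ker L = ⊥ := by
    by_contra hne
    -- Right multiplication by M preserves the kernel, which therefore contains Z ≠ 0 with Z M = z Z
    -- and Mᵀ Z = -z Z. A row of Z makes z an eigenvalue of M and a column makes -z one, so both
    -- would have negative real part.
    have hinv : ∀ Z ∈ LinearMap.ker L, LinearMap.mulRight ℂ M Z ∈ LinearMap.ker L := by
      intro Z hZ
      rw [hL] at hZ ⊢
      have := congrArg (· * M) hZ
      simpa [Matrix.add_mul, Matrix.mul_assoc] using this
    have : Nontrivial (LinearMap.ker L) := Submodule.nontrivial_iff_ne_bot.2 hne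
    obtain ⟨z, hz⟩ := Module.End.exists_eigenvalue ((LinearMap.mulRight ℂ M).restrict hinv)
    obtain ⟨⟨Z, hZ⟩, hy⟩ := hz.exists_hasEigenvector
    have h1 : Z * M = z • Z := congrArg Subtype.val hy.apply_eq_smul
    have h2 : Mᵀ * Z = (-z) • Z := by
      rw [hL, h1] at hZ
      rw [neg_smul]
      exact eq_neg_of_add_eq_zero_right hZ
    have h0 : Z ≠ 0 := fun h => hy.2 (Subtype.ext h)
    obtain ⟨i, j, hij⟩ : ∃ i j, Z i j ≠ 0 := by
      by_contra hcon
      push Not at hcon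
      exact h0 (Matrix.ext hcon)
    have s1 : z.re < 0 := by
      refine hF z (mem_spectrum_of_vecMul (v := Z i) (fun h => hij (congrFun h j)) ?_)
      ext k
      exact congrFun (congrFun h1 i) k
    have s2 : (-z).re < 0 := by
      refine hF (-z) (mem_spectrum_of_vecMul (v := fun r => Z r j)
        (fun h => hij (congrFun h i)) ?_)
      rw [← Matrix.mulVec_transpose]
      ext k
      exact congrFun (congrFun h2 k) j
    rw [Complex.neg_re] at s2
    linarith
  have hmem : (P - P').map (fun a : ℝ => (a : ℂ)) ∈ LinearMap.ker L := by
    rw [hL]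
    have h1 : (P - P') * F + Fᵀ * (P - P') = 0 := by
      rw [Matrix.sub_mul, Matrix.mul_sub, sub_add_sub_comm, h, h', sub_self]
    have h2 := congrArg (fun X : Matrix (Fin n) (Fin n) ℝ => X.map Complex.ofRealHom) h1
    simp only [Matrix.map_add _ (map_add Complex.ofRealHom), Matrix.map_mul,
      Matrix.map_zero _ (map_zero Complex.ofRealHom)] at h2
    exact h2
  rw [hker, Submodule.mem_bot] at hmem
  ext i j
  have := congrFun (congrFun hmem i) j
  exact sub_eq_zero.1 (Complex.ofReal_eq_zero.1 this)

variable {κ : Type*} [Fintype κ]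

theorem posDef_mulVec_eq_zero {ι : Type*} [Fintype ι] {P : Matrix ι ι ℝ}
    (hP : P.PosDef) {v : ι → ℝ} (h : v ⬝ᵥ (P *ᵥ v) = 0) : v = 0 := by
  by_contra hne
  have := hP.dotProduct_mulVec_pos hne
  rw [star_trivial, h] at this
  exact lt_irrefl _ this

/-- A positive definite solution of the Riccati equation of a controllable pair is stabilizing. -/
theorem hurwitz_of_riccati {A P Q : Matrix (Fin n) (Fin n) ℝ} {B : Matrix (Fin n) κ ℝ}
    {R : Matrix κ κ ℝ} {K : Matrix κ (Fin n) ℝ}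
    (hAB : ∀ v : Fin n → ℝ, (∀ i < n, v ᵥ* (A ^ i * B) = 0) → v = 0)
    (hP : P.PosDef) (hQ : Q.PosSemidef) (hR : R.PosDef) (hK : R * K = Bᵀ * P)
    (hric : Q + P * A + Aᵀ * P - Kᵀ * R * K = 0) : IsHurwitz (A - B * K) := by
  have hPs : Pᵀ = P := by
    simpa [Matrix.conjTranspose_eq_transpose_of_trivial] using hP.isHermitian.eq
  have hRs : Rᵀ = R := by
    simpa [Matrix.conjTranspose_eq_transpose_of_trivial] using hR.isHermitian.eq
  have hK' : Kᵀ * R = P * B := by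
    have := congrArg Matrix.transpose hK
    simpa [Matrix.transpose_mul, hRs, hPs] using this
  set F := A - B * K with hF
  have hlyap : P * F + Fᵀ * P = -(Q + Kᵀ * R * K) := by
    have h1 : P * (B * K) = Kᵀ * R * K := by rw [← Matrix.mul_assoc, hK']
    have h2 : (B * K)ᵀ * P = Kᵀ * R * K := by
      rw [Matrix.transpose_mul, Matrix.mul_assoc, ← hK, Matrix.mul_assoc]
    rw [hF, Matrix.mul_sub, Matrix.transpose_sub, Matrix.sub_mul, h1, h2, ← sub_eq_zero, ← hric]
    abel
  have hsymm : ∀ a b : Fin n → ℝ, (P *ᵥ a) ⬝ᵥ b = (P *ᵥ b) ⬝ᵥ a := fun a b => by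
    rw [dotProduct_comm, Matrix.dotProduct_mulVec, ← Matrix.mulVec_transpose, hPs]
  have hq : ∀ a : Fin n → ℝ,
      2 * ((P *ᵥ a) ⬝ᵥ (F *ᵥ a)) = -(a ⬝ᵥ (Q *ᵥ a) + (K *ᵥ a) ⬝ᵥ (R *ᵥ (K *ᵥ a))) := by
    intro a
    have h1 := congrArg (fun M => a ⬝ᵥ (M *ᵥ a)) hlyap
    simp only [Matrix.add_mulVec, Matrix.neg_mulVec, dotProduct_add, dotProduct_neg,
      ← Matrix.mulVec_mulVec] at h1
    rw [Matrix.dotProduct_mulVec a P, ← Matrix.mulVec_transpose, hPs,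
      Matrix.dotProduct_mulVec a Fᵀ, Matrix.vecMul_transpose,
      Matrix.dotProduct_mulVec a Kᵀ, Matrix.vecMul_transpose, dotProduct_comm (F *ᵥ a)] at h1
    linarith
  have hQ0 : ∀ a : Fin n → ℝ, 0 ≤ a ⬝ᵥ (Q *ᵥ a) := fun a => by
    simpa using hQ.dotProduct_mulVec_nonneg a
  have hR0 : ∀ a : κ → ℝ, 0 ≤ a ⬝ᵥ (R *ᵥ a) := fun a => by
    simpa using hR.posSemidef.dotProduct_mulVec_nonneg a
  have hP0 : ∀ a : Fin n → ℝ, 0 ≤ a ⬝ᵥ (P *ᵥ a) := fun a => by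
    simpa using hP.posSemidef.dotProduct_mulVec_nonneg a
  intro z hz
  obtain ⟨v, hv0, hv⟩ := exists_mulVec_of_mem_spectrum hz
  let a : Fin n → ℝ := fun i => (v i).re
  let b : Fin n → ℝ := fun i => (v i).im
  have ha : F *ᵥ a = z.re • a - z.im • b := by
    ext i
    have := congrArg Complex.re (congrFun hv i)
    simpa [Matrix.mulVec, dotProduct, a, b] using this
  have hb : F *ᵥ b = z.im • a + z.re • b := by
    ext i
    have := congrArg Complex.im (congrFun hv i)
    simpa [Matrix.mulVec, dotProduct, a, b, add_comm] using this
  have hab : ¬ (a = 0 ∧ b = 0) := fun ⟨h1, h2⟩ =>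
    hv0 (funext fun i => Complex.ext (congrFun h1 i) (congrFun h2 i))
  have hqa := hq a
  have hqb := hq b
  rw [ha, dotProduct_sub, dotProduct_smul, dotProduct_smul, smul_eq_mul, smul_eq_mul,
    hsymm a b, dotProduct_comm _ a] at hqa
  rw [hb, dotProduct_add, dotProduct_smul, dotProduct_smul, smul_eq_mul, smul_eq_mul,
    dotProduct_comm _ b] at hqb
  have hpos : 0 < a ⬝ᵥ (P *ᵥ a) + b ⬝ᵥ (P *ᵥ b) := by
    refine lt_of_le_of_ne (add_nonneg (hP0 a) (hP0 b)) fun h => hab ?_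
    have h1 := hP0 a
    have h2 := hP0 b
    exact ⟨posDef_mulVec_eq_zero hP (by linarith), posDef_mulVec_eq_zero hP (by linarith)⟩
  by_contra hre
  have hre : 0 ≤ z.re := not_lt.1 hre
  -- Adding the Lyapunov identities for the real and imaginary parts of the eigenvector cancels the
  -- terms with z.im. Hence z.re ≥ 0 forces z.re = 0 and makes both Q- and R-terms vanish.
  have hsum : 2 * (z.re * (a ⬝ᵥ (P *ᵥ a) + b ⬝ᵥ (P *ᵥ b)))
      = -(a ⬝ᵥ (Q *ᵥ a) + (K *ᵥ a) ⬝ᵥ (R *ᵥ (K *ᵥ a)))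
        - (b ⬝ᵥ (Q *ᵥ b) + (K *ᵥ b) ⬝ᵥ (R *ᵥ (K *ᵥ b))) := by
    linarith
  have hnn := mul_nonneg hre hpos.le
  have e1 := hQ0 a
  have e2 := hQ0 b
  have e3 := hR0 (K *ᵥ a)
  have e4 := hR0 (K *ᵥ b)
  have hz0 : z.re = 0 := by
    have : z.re * (a ⬝ᵥ (P *ᵥ a) + b ⬝ᵥ (P *ᵥ b)) = 0 := by linarith
    exact (mul_eq_zero.1 this).resolve_right hpos.ne'
  -- For z on the imaginary axis, P a and P b lie in the left kernel of B and span a subspace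
  -- invariant under right multiplication by A, so controllability makes them zero.
  have hker : ∀ c : Fin n → ℝ, c ⬝ᵥ (Q *ᵥ c) = 0 → (K *ᵥ c) ⬝ᵥ (R *ᵥ (K *ᵥ c)) = 0 →
      (P *ᵥ c) ᵥ* B = 0 ∧ (P *ᵥ c) ᵥ* A = -(P *ᵥ (F *ᵥ c)) := by
    intro c h1 h2
    have hKc := posDef_mulVec_eq_zero hR h2
    have hQc : Q *ᵥ c = 0 := (hQ.dotProduct_mulVec_zero_iff c).1 (by simpa using h1)
    have hBc : (P *ᵥ c) ᵥ* B = 0 := by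
      rw [← Matrix.mulVec_transpose, Matrix.mulVec_mulVec, ← hK, ← Matrix.mulVec_mulVec, hKc,
        Matrix.mulVec_zero]
    refine ⟨hBc, ?_⟩
    have h3 := congrArg (fun M => M *ᵥ c) hlyap
    simp only [Matrix.add_mulVec, Matrix.neg_mulVec, ← Matrix.mulVec_mulVec, hQc, hKc,
      Matrix.mulVec_zero, add_zero, neg_zero] at h3
    have h4 : Fᵀ *ᵥ (P *ᵥ c) = (P *ᵥ c) ᵥ* A := by
      rw [hF, Matrix.mulVec_transpose, Matrix.vecMul_sub, ← Matrix.vecMul_vecMul, hBc,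
        Matrix.zero_vecMul, sub_zero]
    rw [h4] at h3
    exact eq_neg_of_add_eq_zero_right h3
  obtain ⟨hBa, hAa⟩ := hker a (by linarith) (by linarith)
  obtain ⟨hBb, hAb⟩ := hker b (by linarith) (by linarith)
  rw [ha, hz0, zero_smul, zero_sub, Matrix.mulVec_neg, neg_neg, Matrix.mulVec_smul] at hAa
  rw [hb, hz0, zero_smul, add_zero, Matrix.mulVec_smul] at hAb
  have hall : ∀ i, (P *ᵥ a) ᵥ* (A ^ i * B) = 0 ∧ (P *ᵥ b) ᵥ* (A ^ i * B) = 0 := by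
    intro i
    induction i with
    | zero => simp [hBa, hBb]
    | succ i ih =>
      rw [pow_succ', Matrix.mul_assoc, ← Matrix.vecMul_vecMul, ← Matrix.vecMul_vecMul (P *ᵥ b),
        hAa, hAb, Matrix.neg_vecMul, Matrix.smul_vecMul, Matrix.smul_vecMul, ih.1, ih.2]
      simp
  have hPa := hAB _ fun i _ => (hall i).1
  have hPb := hAB _ fun i _ => (hall i).2
  exact hab ⟨posDef_mulVec_eq_zero hP (by rw [hPa, dotProduct_zero]),
    posDef_mulVec_eq_zero hP (by rw [hPb, dotProduct_zero])⟩

end Hurwitz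

/-! ### Enlarging strict solutions of the Riccati inequality. -/

section RiccatiInequality

open Filter Topology

variable {n : ℕ}

/-- By |v_i v_j| ≤ (v_i² + v_j²)/2 the quadratic form of H is at most n/(n+1) times |v|². -/
theorem posSemidef_one_sub_of_small {H : Matrix (Fin n) (Fin n) ℝ} (hs : Hᵀ = H)
    (h : ∀ i j, |H i j| ≤ 1 / (n + 1)) : (1 - H).PosSemidef := by
  refine PosSemidef.of_dotProduct_mulVec_nonneg ?_ fun v => ?_
  · rw [Matrix.IsHermitian, Matrix.conjTranspose_eq_transpose_of_trivial, Matrix.transpose_sub, hs,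
      Matrix.transpose_one]
  · rw [star_trivial, Matrix.sub_mulVec, Matrix.one_mulVec, dotProduct_sub, sub_nonneg]
    have h1 : ∀ i j, v i * (H i j * v j) ≤ 1 / (n + 1) * ((v i ^ 2 + v j ^ 2) / 2) := by
      intro i j
      calc v i * (H i j * v j) ≤ |v i * (H i j * v j)| := le_abs_self _
        _ = |H i j| * (|v i| * |v j|) := by rw [abs_mul, abs_mul]; ring
        _ ≤ 1 / (n + 1) * (|v i| * |v j|) := by gcongr; exact h i j
        _ ≤ _ := by
          gcongr
          nlinarith [sq_nonneg (|v i| - |v j|), sq_abs (v i), sq_abs (v j)]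
    calc v ⬝ᵥ (H *ᵥ v) = ∑ i, ∑ j, v i * (H i j * v j) := by
          simp [Matrix.mulVec, dotProduct, Finset.mul_sum]
      _ ≤ ∑ i, ∑ j, 1 / ((n : ℝ) + 1) * ((v i ^ 2 + v j ^ 2) / 2) :=
          Finset.sum_le_sum fun i _ => Finset.sum_le_sum fun j _ => h1 i j
      _ = n / (n + 1) * ∑ i, v i ^ 2 := by
          simp only [← Finset.mul_sum, ← Finset.sum_div, Finset.sum_add_distrib, Finset.sum_const,
            Finset.card_univ, Fintype.card_fin, nsmul_eq_mul]
          ring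
      _ ≤ 1 * ∑ i, v i ^ 2 := by
          gcongr
          rw [div_le_one (by positivity)]
          linarith
      _ = v ⬝ᵥ v := by simp [dotProduct, pow_two]

theorem eventually_posSemidef_one_sub {H : ℝ → Matrix (Fin n) (Fin n) ℝ} (hs : ∀ e, (H e)ᵀ = H e)
    (hc : ContinuousAt H 0) (h0 : H 0 = 0) : ∀ᶠ e in 𝓝 (0 : ℝ), (1 - H e).PosSemidef := by
  have h1 : ∀ i j, ∀ᶠ e in 𝓝 (0 : ℝ), |H e i j| < 1 / (n + 1) := fun i j => by
    have h2 : Tendsto (fun e => |H e i j|) (𝓝 0) (𝓝 |H 0 i j|) :=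
      (((continuous_id (X := Matrix (Fin n) (Fin n) ℝ)).matrix_elem i j).abs.tendsto (H 0)).comp hc
    refine h2.eventually_lt_const ?_
    rw [h0, Matrix.zero_apply, abs_zero]
    positivity
  filter_upwards [eventually_all.2 fun i => eventually_all.2 fun j => h1 i j] with e he
  exact posSemidef_one_sub_of_small (hs e) fun i j => (he i j).le

open scoped MatrixOrder Matrix.Norms.L2Operator in
theorem exists_eq_transpose_mul_self {D : Matrix (Fin n) (Fin n) ℝ} (h : D.PosSemidef) :
    ∃ L : Matrix (Fin n) (Fin n) ℝ, D = Lᵀ * L := by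
  obtain ⟨L, hL⟩ := CStarAlgebra.nonneg_iff_eq_star_mul_self.mp h.nonneg
  exact ⟨L, by rw [hL, Matrix.star_eq_conjTranspose,
    Matrix.conjTranspose_eq_transpose_of_trivial]⟩

/-- The Riccati map is quadratic, so its second-order expansion at P is exact. For symmetric P and S
the linear part is the Lyapunov operator of A - S P. -/
theorem riccati_shift (A P Q S X : Matrix (Fin n) (Fin n) ℝ) (e : ℝ) :
    Q + (P + e • X) * A + Aᵀ * (P + e • X) - (P + e • X) * S * (P + e • X)
      = (Q + P * A + Aᵀ * P - P * S * P) + e • (X * (A - S * P) + (Aᵀ - P * S) * X)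
        - e ^ 2 • (X * S * X) := by
  simp only [Matrix.add_mul, Matrix.mul_add, Matrix.sub_mul, Matrix.mul_sub, Matrix.smul_mul,
    Matrix.mul_smul, Matrix.mul_assoc]
  module

/-- A strict solution of the Riccati inequality can be enlarged. -/
theorem exists_larger_riccati {A P Q S : Matrix (Fin n) (Fin n) ℝ} (hP : P.PosDef) (hS : Sᵀ = S)
    (h : (Q + P * A + Aᵀ * P - P * S * P).PosSemidef)
    (hne : Q + P * A + Aᵀ * P - P * S * P ≠ 0) :
    ∃ P' : Matrix (Fin n) (Fin n) ℝ, P'.PosDef ∧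
      (Q + P' * A + Aᵀ * P' - P' * S * P').PosSemidef ∧ P.trace < P'.trace := by
  have hPs : Pᵀ = P := by
    simpa [Matrix.conjTranspose_eq_transpose_of_trivial] using hP.isHermitian.eq
  set D := Q + P * A + Aᵀ * P - P * S * P with hD
  obtain ⟨L, hL⟩ := exists_eq_transpose_mul_self h
  set F := A - S * P with hF
  have hFt : Fᵀ = Aᵀ - P * S := by
    rw [hF, Matrix.transpose_sub, Matrix.transpose_mul, hPs, hS]
  -- The defect D may be singular, so an arbitrary small increment could leave the cone. The
  -- increment e X is chosen with D = (1 - eF)ᵀ X (1 - eF), which turns the first-order change into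
  -- D + e(XF + FᵀX) = X + e² FᵀXF.
  let C : ℝ → Matrix (Fin n) (Fin n) ℝ := fun e => (1 - e • F)⁻¹
  have hdet : Continuous fun e : ℝ => (1 - e • F).det := by fun_prop
  have hCc : ContinuousAt C 0 := by
    simp only [C, Matrix.inv_def, Ring.inverse_eq_inv']
    exact (hdet.continuousAt.inv₀ (by simp)).smul (by fun_prop)
  have hunit : ∀ᶠ e in 𝓝 (0 : ℝ), (1 - e • F).det ≠ 0 :=
    hdet.continuousAt.eventually_ne (by simp)
  -- H e carries the quadratic loss: X - e² X S X = (L C)ᵀ (1 - H e) (L C), which is positive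
  -- semidefinite for small e.
  let H : ℝ → Matrix (Fin n) (Fin n) ℝ := fun e => e ^ 2 • (L * C e * S * (L * C e)ᵀ)
  have hHc : ContinuousAt H 0 := by
    have h1 : ContinuousAt (fun e => L * C e) 0 := continuousAt_const.mul hCc
    have h2 : ContinuousAt (fun e => (L * C e)ᵀ) 0 :=
      (continuous_id.matrix_transpose.continuousAt).comp (f := fun e => L * C e) h1
    exact (by fun_prop : ContinuousAt (fun e : ℝ => e ^ 2) 0).smul
      ((h1.mul continuousAt_const).mul h2)
  have hHs : ∀ e, (H e)ᵀ = H e := fun e => by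
    simp only [H, Matrix.transpose_smul, Matrix.transpose_mul, Matrix.transpose_transpose, hS,
      Matrix.mul_assoc]
  have hev := (eventually_posSemidef_one_sub hHs hHc (by simp [H])).and hunit
  obtain ⟨e, ⟨he1, he2⟩, he0⟩ :=
    ((hev.filter_mono nhdsWithin_le_nhds).and (self_mem_nhdsWithin : Set.Ioi (0 : ℝ) ∈ _)).exists
  have he0 : 0 < e := he0
  have hCi : C e * (1 - e • F) = 1 :=
    Matrix.nonsing_inv_mul _ (isUnit_iff_ne_zero.2 he2)
  set X := (L * C e)ᵀ * (L * C e) with hX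
  have hXpsd : X.PosSemidef := by
    have := Matrix.posSemidef_conjTranspose_mul_self (L * C e)
    rwa [Matrix.conjTranspose_eq_transpose_of_trivial] at this
  have hDX : D = (1 - e • F)ᵀ * X * (1 - e • F) := by
    have h1 : L * C e * (1 - e • F) = L := by rw [Matrix.mul_assoc, hCi, Matrix.mul_one]
    calc D = (L * C e * (1 - e • F))ᵀ * (L * C e * (1 - e • F)) := by rw [h1, hL]
      _ = _ := by rw [hX, Matrix.transpose_mul (L * C e)]; simp only [Matrix.mul_assoc]
  have hX0 : X ≠ 0 := fun h0 => hne (by rw [hDX, h0]; simp)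
  refine ⟨P + e • X, hP.add_posSemidef (hXpsd.smul he0.le), ?_, ?_⟩
  · rw [riccati_shift, ← hD, ← hF, ← hFt]
    have h1 : D + e • (X * F + Fᵀ * X) - e ^ 2 • (X * S * X)
        = (L * C e)ᵀ * (1 - H e) * (L * C e) + e ^ 2 • (Fᵀ * X * F) := by
      have h2 : (L * C e)ᵀ * (1 - H e) * (L * C e) = X - e ^ 2 • (X * S * X) := by
        simp only [H, hX, Matrix.mul_sub, Matrix.sub_mul, Matrix.mul_one, Matrix.mul_smul,
          Matrix.smul_mul, Matrix.mul_assoc]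
      rw [h2]
      nth_rewrite 1 [hDX]
      simp only [Matrix.transpose_sub, Matrix.transpose_one, Matrix.transpose_smul,
        Matrix.mul_sub, Matrix.sub_mul, Matrix.mul_one, Matrix.one_mul, Matrix.mul_smul,
        Matrix.smul_mul, Matrix.mul_assoc]
      module
    rw [h1]
    have h3 := he1.conjTranspose_mul_mul_same (L * C e)
    have h4 := hXpsd.conjTranspose_mul_mul_same F
    rw [Matrix.conjTranspose_eq_transpose_of_trivial] at h3 h4
    exact h3.add (h4.smul (by positivity))
  · rw [Matrix.trace_add, Matrix.trace_smul, smul_eq_mul]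
    have h1 : 0 < X.trace :=
      lt_of_le_of_ne hXpsd.trace_nonneg fun h0 => hX0 (hXpsd.trace_eq_zero_iff.1 h0.symm)
    have := mul_pos he0 h1
    linarith

end RiccatiInequality
end NZSGame

namespace NZSGame
open Matrix

/-! ### Block matrices and positive definite weights. -/

section Blocks

variable {n N k : ℕ} {m : Fin N → ℕ}

theorem stackCols_mul_stackRows (B : ∀ i, Matrix (Fin n) (Fin (m i)) ℝ)
    (U : ∀ i, Matrix (Fin (m i)) (Fin k) ℝ) : stackCols B * stackRows U = ∑ i, B i * U i := by
  ext r c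
  simp [Matrix.mul_apply, Matrix.sum_apply, stackCols, stackRows, Fintype.sum_sigma]

theorem closedLoop_eq (A : Matrix (Fin n) (Fin n) ℝ) (B : ∀ i, Matrix (Fin n) (Fin (m i)) ℝ)
    (K : ∀ i, Matrix (Fin (m i)) (Fin n) ℝ) :
    closedLoop A B K = A - stackCols B * stackRows K := by
  rw [closedLoop, stackCols_mul_stackRows]

theorem blockDiagonal'_mul_stackRows (R : ∀ i, Matrix (Fin (m i)) (Fin (m i)) ℝ)
    (U : ∀ i, Matrix (Fin (m i)) (Fin k) ℝ) :
    blockDiagonal' R * stackRows U = stackRows fun i => R i * U i := by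
  ext ⟨i, a⟩ c
  simp only [Matrix.mul_apply, stackRows, Matrix.of_apply, Fintype.sum_sigma]
  rw [Finset.sum_eq_single i]
  · simp
  · intro j _ hj
    simp [Matrix.blockDiagonal'_apply_ne _ _ _ hj.symm]
  · simp

theorem posDef_blockDiagonal' {R : ∀ i, Matrix (Fin (m i)) (Fin (m i)) ℝ}
    (hR : ∀ i, (R i).PosDef) : (blockDiagonal' R).PosDef := by
  refine PosDef.of_dotProduct_mulVec_pos ?_ fun v hv => ?_
  · rw [Matrix.IsHermitian, Matrix.blockDiagonal'_conjTranspose]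
    congr 1
    ext i : 1
    exact (hR i).isHermitian.eq
  have hsum : star v ⬝ᵥ (blockDiagonal' R *ᵥ v)
      = ∑ i, (fun a => v ⟨i, a⟩) ⬝ᵥ (R i *ᵥ fun a => v ⟨i, a⟩) := by
    simp only [star_trivial, dotProduct, Matrix.mulVec, Fintype.sum_sigma]
    refine Finset.sum_congr rfl fun i _ => Finset.sum_congr rfl fun a _ => ?_
    congr 1
    rw [Finset.sum_eq_single i]
    · simp
    · intro j _ hj
      simp [Matrix.blockDiagonal'_apply_ne _ _ _ hj.symm]
    · simp
  obtain ⟨⟨i, a⟩, hi⟩ : ∃ p, v p ≠ 0 := by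
    by_contra hcon
    push Not at hcon
    exact hv (funext hcon)
  rw [hsum]
  refine Finset.sum_pos' (fun j _ => ?_) ⟨i, Finset.mem_univ i, ?_⟩
  · simpa using (hR j).posSemidef.dotProduct_mulVec_nonneg fun a => v ⟨j, a⟩
  · simpa using (hR i).dotProduct_mulVec_pos (x := fun a => v ⟨i, a⟩)
      fun h => hi (congrFun h a)

theorem eq_zero_of_transpose_mul_mul {κ ι : Type*} [Fintype κ] {R : Matrix κ κ ℝ}
    (hR : R.PosDef) {E : Matrix κ ι ℝ} (h : Eᵀ * R * E = 0) : E = 0 := by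
  have hcol : ∀ c, (fun p => E p c) = 0 := fun c => by
    refine posDef_mulVec_eq_zero hR ?_
    have := congrFun (congrFun h c) c
    rw [Matrix.mul_assoc] at this
    exact this
  ext p c
  exact congrFun (hcol c) p

theorem PosDef.transpose_eq {κ : Type*} {P : Matrix κ κ ℝ} (hP : P.PosDef) : Pᵀ = P := by
  simpa [Matrix.conjTranspose_eq_transpose_of_trivial] using hP.isHermitian.eq

end Blocks

/-! ### Completing squares and comparing the two algorithms. -/

section Algorithms

variable {n N η : ℕ} {m : Fin N → ℕ} {A : Matrix (Fin n) (Fin n) ℝ}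
  {B : ∀ i, Matrix (Fin n) (Fin (m i)) ℝ} {w : Weights n N m} {d : DataMatrices n N m η}
  {P Qa : Matrix (Fin n) (Fin n) ℝ}

/-- The feedback matrices `R_ii⁻¹ B_iᵀ P`. -/
noncomputable def gain (B : ∀ i, Matrix (Fin n) (Fin (m i)) ℝ) (w : Weights n N m)
    (P : Matrix (Fin n) (Fin n) ℝ) (i : Fin N) : Matrix (Fin (m i)) (Fin n) ℝ :=
  (w.R i i)⁻¹ * (B i)ᵀ * P

/-- The equations for `[X; U_1; …; U_N]` are solvable for all right-hand sides. -/
def DataMatrices.IsRich (d : DataMatrices n N m η) : Prop :=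
  ∀ (k : ℕ) (Y : Matrix (Fin n) (Fin k) ℝ) (V : ∀ i, Matrix (Fin (m i)) (Fin k) ℝ),
    ∃ Γ : Matrix (Fin η) (Fin k) ℝ, d.X * Γ = Y ∧ ∀ i, d.U i * Γ = V i

/-- The data satisfy the dynamics with system matrices `A`, `B`. -/
def DataMatrices.Explains (d : DataMatrices n N m η) (A : Matrix (Fin n) (Fin n) ℝ)
    (B : ∀ i, Matrix (Fin n) (Fin (m i)) ℝ) : Prop :=
  d.Xd = A * d.X + ∑ i, B i * d.U i

theorem mul_gain (hw : w.Admissible) (i : Fin N) : w.R i i * gain B w P i = (B i)ᵀ * P := by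
  rw [gain, Matrix.mul_assoc, Matrix.mul_nonsing_inv_cancel_left]
  exact (Matrix.isUnit_iff_isUnit_det _).1 (hw.2.1 i).isUnit

theorem transpose_gain_mul (hw : w.Admissible) (hP : P.PosDef) (i : Fin N) :
    (gain B w P i)ᵀ * w.R i i = P * B i := by
  have := congrArg Matrix.transpose (mul_gain (B := B) (P := P) hw i)
  simpa [Matrix.transpose_mul, PosDef.transpose_eq hP, PosDef.transpose_eq (hw.2.1 i)] using this

theorem mul_stackRows_gain (hw : w.Admissible) :
    blockDiagonal' (fun i => w.R i i) * stackRows (gain B w P) = (stackCols B)ᵀ * P := by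
  rw [blockDiagonal'_mul_stackRows]
  ext ⟨i, a⟩ c
  exact congrFun (congrFun (mul_gain hw i) a) c

theorem transpose_stackRows_gain_mul (hw : w.Admissible) (hP : P.PosDef) :
    (stackRows (gain B w P))ᵀ * blockDiagonal' (fun i => w.R i i) = P * stackCols B := by
  have := congrArg Matrix.transpose (mul_stackRows_gain (B := B) (P := P) hw)
  rwa [Matrix.transpose_mul, PosDef.transpose_eq (posDef_blockDiagonal' hw.2.1),
    Matrix.transpose_mul, Matrix.transpose_transpose, PosDef.transpose_eq hP] at this

/-- Completing the square in U with the gain R⁻¹BᵀP separates the Riccati defect from the only term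
in which U occurs. -/
theorem lqrOp_eq (hw : w.Admissible) (hd : d.Explains A B) (hP : P.PosDef) :
    lqrOp d w Qa P = d.Xᵀ * (Qa + P * A + Aᵀ * P - (stackRows (gain B w P))ᵀ *
        blockDiagonal' (fun i => w.R i i) * stackRows (gain B w P)) * d.X
      + (stackRows d.U + stackRows (gain B w P) * d.X)ᵀ * blockDiagonal' (fun i => w.R i i) *
        (stackRows d.U + stackRows (gain B w P) * d.X) := by
  set R := blockDiagonal' (fun i => w.R i i) with hR
  set K := stackRows (gain B w P) with hK
  have h1 : R * K = (stackCols B)ᵀ * P := mul_stackRows_gain hw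
  have h2 : Kᵀ * R = P * stackCols B := transpose_stackRows_gain_mul hw hP
  have h3 : ∀ {k : ℕ} (Z : Matrix (Fin n) (Fin k) ℝ), R * (K * Z) = (stackCols B)ᵀ * (P * Z) :=
    fun Z => by rw [← Matrix.mul_assoc, h1, Matrix.mul_assoc]
  have h4 : ∀ {k : ℕ} (Z : Matrix (Σ i, Fin (m i)) (Fin k) ℝ),
      Kᵀ * (R * Z) = P * (stackCols B * Z) :=
    fun Z => by rw [← Matrix.mul_assoc, h2, Matrix.mul_assoc]
  have hXd : d.Xd = A * d.X + stackCols B * stackRows d.U := by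
    rw [stackCols_mul_stackRows]; exact hd
  have h5 : Kᵀ * ((stackCols B)ᵀ * (P * d.X)) = P * (stackCols B * (K * d.X)) := by
    rw [← h3, h4]
  rw [lqrOp, hXd, ← hR]
  simp only [Matrix.transpose_add, Matrix.transpose_mul, Matrix.mul_add, Matrix.add_mul,
    Matrix.mul_sub, Matrix.sub_mul, Matrix.mul_assoc, h3, h4, h5]
  abel

theorem riccati_of_solvesLQR (hw : w.Admissible) (hd : d.Explains A B) (hr : d.IsRich)
    (h : SolvesLQR d w Qa P) :
    Qa + P * A + Aᵀ * P - (stackRows (gain B w P))ᵀ * blockDiagonal' (fun i => w.R i i) *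
      stackRows (gain B w P) = 0 := by
  obtain ⟨⟨hP, hL⟩, hmax⟩ := h
  set R := blockDiagonal' (fun i => w.R i i) with hR
  have hRp : R.PosDef := posDef_blockDiagonal' hw.2.1
  have hRd : IsUnit R.det := (Matrix.isUnit_iff_isUnit_det _).1 hRp.isUnit
  set S := stackCols B * R⁻¹ * (stackCols B)ᵀ with hS
  have hSs : Sᵀ = S := by
    rw [hS, Matrix.transpose_mul, Matrix.transpose_mul, Matrix.transpose_nonsing_inv,
      PosDef.transpose_eq hRp, Matrix.transpose_transpose, Matrix.mul_assoc]
  have hKS : ∀ P' : Matrix (Fin n) (Fin n) ℝ, P'.PosDef →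
      (stackRows (gain B w P'))ᵀ * R * stackRows (gain B w P') = P' * S * P' := by
    intro P' hP'
    have h1 : stackRows (gain B w P') = R⁻¹ * ((stackCols B)ᵀ * P') := by
      rw [← mul_stackRows_gain hw, Matrix.nonsing_inv_mul_cancel_left _ _ hRd]
    rw [transpose_stackRows_gain_mul hw hP', h1, hS]
    simp only [Matrix.mul_assoc]
  have hpsd : (Qa + P * A + Aᵀ * P - P * S * P).PosSemidef := by
    -- This Γ annihilates the square, so compressing 𝓛(P) by Γ leaves exactly the Riccati defect.
    obtain ⟨Γ, hX, hU⟩ := hr n 1 fun i => -gain B w P i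
    have hE : (stackRows d.U + stackRows (gain B w P) * d.X) * Γ = 0 := by
      rw [Matrix.add_mul, Matrix.mul_assoc, hX, Matrix.mul_one]
      ext ⟨i, a⟩ c
      have := congrFun (congrFun (hU i) a) c
      rw [Matrix.add_apply, show (stackRows d.U * Γ) ⟨i, a⟩ c = (d.U i * Γ) a c from rfl, this]
      simp [stackRows]
    have h1 := hL.conjTranspose_mul_mul_same Γ
    rw [lqrOp_eq hw hd hP, ← hR, hKS P hP, Matrix.conjTranspose_eq_transpose_of_trivial] at h1
    convert h1 using 1
    have hX' : Γᵀ * d.Xᵀ = 1 := by rw [← Matrix.transpose_mul, hX, Matrix.transpose_one]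
    generalize Qa + P * A + Aᵀ * P - P * S * P = D
    generalize stackRows d.U + stackRows (gain B w P) * d.X = V at hE
    simp only [Matrix.mul_add, Matrix.add_mul, Matrix.mul_assoc, hE, hX, Matrix.mul_one,
      Matrix.mul_zero, add_zero]
    rw [← Matrix.mul_assoc, hX', Matrix.one_mul]
  rw [hKS P hP]
  by_contra hne
  obtain ⟨P', hP', hpsd', htr⟩ := exists_larger_riccati hP hSs hpsd hne
  refine absurd (hmax P' hP' ?_) (not_le.2 htr)
  rw [lqrOp_eq hw hd hP', ← hR, hKS P' hP']
  have h3 := hpsd'.conjTranspose_mul_mul_same d.X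
  have h4 := hRp.posSemidef.conjTranspose_mul_mul_same
    (stackRows d.U + stackRows (gain B w P') * d.X)
  rw [Matrix.conjTranspose_eq_transpose_of_trivial] at h3 h4
  exact h3.add h4

theorem lqrOp_eq_of_solvesLQR (hw : w.Admissible) (hd : d.Explains A B) (hr : d.IsRich)
    (h : SolvesLQR d w Qa P) :
    lqrOp d w Qa P = (stackRows d.U + stackRows (gain B w P) * d.X)ᵀ *
      blockDiagonal' (fun i => w.R i i) * (stackRows d.U + stackRows (gain B w P) * d.X) := by
  rw [lqrOp_eq hw hd h.1.1, riccati_of_solvesLQR hw hd hr h]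
  simp

theorem stackRows_mul (U : ∀ i, Matrix (Fin (m i)) (Fin η) ℝ) {k : ℕ}
    (Γ : Matrix (Fin η) (Fin k) ℝ) : stackRows U * Γ = stackRows fun i => U i * Γ := rfl

theorem exists_dataInit (hw : w.Admissible) (hd : d.Explains A B) (hr : d.IsRich)
    (h : SolvesLQR d w Qa P) : ∃ K0 S, DataInit d w Qa P K0 S := by
  obtain ⟨Γ0, hX, hU⟩ := hr n 1 fun i => -gain B w P i
  have hz : ∀ i, ∃ Γ : Matrix (Fin η) (Fin n) ℝ, d.X * Γ = 1 ∧
      ∀ j, d.U j * Γ = if j = i then 0 else -gain B w P j := fun i => hr n 1 _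
  choose Γz hXz hUz using hz
  refine ⟨gain B w P, fun i => d.Xd * (Γz i - Γ0) * P⁻¹, h, Γ0, Γz, hX, ?_,
    fun i => by rw [hU, neg_neg], fun i => ⟨hXz i, by simp [hUz], fun j hj => by simp [hUz, hj]⟩,
    fun i => rfl⟩
  have hE : (stackRows d.U + stackRows (gain B w P) * d.X) * Γ0 = 0 := by
    rw [Matrix.add_mul, Matrix.mul_assoc, hX, Matrix.mul_one, stackRows_mul]
    ext ⟨i, a⟩ c
    simp [hU, stackRows]
  rw [lqrOp_eq_of_solvesLQR hw hd hr h, Matrix.mul_assoc, hE, Matrix.mul_zero]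

theorem DataInit.eq_gain (hw : w.Admissible) (hd : d.Explains A B) (hr : d.IsRich)
    {K0 : ∀ i, Matrix (Fin (m i)) (Fin n) ℝ} {S : Fin N → Matrix (Fin n) (Fin n) ℝ}
    (h : DataInit d w Qa P K0 S) :
    K0 = gain B w P ∧ ∀ i, S i = B i * (w.R i i)⁻¹ * (B i)ᵀ := by
  obtain ⟨hs, Γ0, Γz, hX, hL, hK, hz, hS⟩ := h
  rw [lqrOp_eq_of_solvesLQR hw hd hr hs, Matrix.mul_assoc] at hL
  -- Γ' reproduces the residual V = UΓ⁰ + K as (U + KX)Γ'. Multiplying (U + KX)ᵀ R V = 0 by Γ'ᵀ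
  -- gives Vᵀ R V = 0, hence V = 0.
  obtain ⟨Γ', hX', hU'⟩ := hr n 0 fun i => d.U i * Γ0 + gain B w P i
  have hE : (stackRows d.U + stackRows (gain B w P) * d.X) * Γ0
      = stackRows fun i => d.U i * Γ0 + gain B w P i := by
    rw [Matrix.add_mul, Matrix.mul_assoc, hX, Matrix.mul_one]
    rfl
  have hE' : (stackRows d.U + stackRows (gain B w P) * d.X) * Γ'
      = stackRows fun i => d.U i * Γ0 + gain B w P i := by
    rw [Matrix.add_mul, Matrix.mul_assoc, hX', Matrix.mul_zero, add_zero, stackRows_mul]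
    simp only [hU']
  have h0 := congrArg (fun M => Γ'ᵀ * M) hL
  simp only [hE, Matrix.mul_zero] at h0
  rw [Matrix.mul_assoc, ← Matrix.mul_assoc, ← Matrix.transpose_mul, hE', ← Matrix.mul_assoc] at h0
  have h1 := eq_zero_of_transpose_mul_mul (posDef_blockDiagonal' hw.2.1) h0
  have hK0 : ∀ i, K0 i = gain B w P i := fun i => by
    have h2 : d.U i * Γ0 + gain B w P i = 0 := by
      ext a c
      exact congrFun (congrFun h1 ⟨i, a⟩) c
    rw [hK, eq_neg_of_add_eq_zero_left h2, neg_neg]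
  refine ⟨funext hK0, fun i => ?_⟩
  -- Γz i and Γ0 agree after multiplication by X and by every U j with j ≠ i, so only the B i term
  -- survives.
  have hdiff : d.Xd * (Γz i - Γ0) = B i * gain B w P i := by
    rw [hd, Matrix.add_mul, Matrix.mul_assoc, Matrix.mul_sub, hX, (hz i).1, sub_self,
      Matrix.mul_zero, zero_add, Matrix.sum_mul, Finset.sum_eq_single i]
    · rw [Matrix.mul_assoc, Matrix.mul_sub, (hz i).2.1, zero_sub, ← hK, hK0]
    · intro j _ hj
      rw [Matrix.mul_assoc, Matrix.mul_sub, (hz i).2.2 j hj, hK, neg_neg, sub_self,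
        Matrix.mul_zero]
    · simp
  rw [hS, hdiff, gain]
  have hPd : IsUnit P.det := (Matrix.isUnit_iff_isUnit_det _).1 hs.1.1.isUnit
  rw [← Matrix.mul_assoc, Matrix.mul_nonsing_inv_cancel_right _ _ hPd, Matrix.mul_assoc]

theorem DataInit.isHurwitz (hw : w.Admissible) (hd : d.Explains A B) (hr : d.IsRich)
    (hAB : IsControllable A (stackCols B)) (hQa : Qa.PosSemidef)
    {K0 : ∀ i, Matrix (Fin (m i)) (Fin n) ℝ} {S : Fin N → Matrix (Fin n) (Fin n) ℝ}
    (h : DataInit d w Qa P K0 S) : IsHurwitz (closedLoop A B K0) := by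
  rw [(h.eq_gain hw hd hr).1, closedLoop_eq]
  refine hurwitz_of_riccati (fun v hv => ?_) h.1.1.1 hQa (posDef_blockDiagonal' hw.2.1)
    (mul_stackRows_gain hw) (riccati_of_solvesLQR hw hd hr h.1)
  refine vecMul_eq_zero_of_rank_eq_card (hAB.trans (Fintype.card_fin n).symm) ?_
  ext p
  exact congrFun (hv p.1 p.1.2) p.2

theorem SolvesGamma.mul_Xd (hd : d.Explains A B) {K : ∀ i, Matrix (Fin (m i)) (Fin n) ℝ}
    {Γ : Matrix (Fin η) (Fin n) ℝ} (h : SolvesGamma d K Γ) : d.Xd * Γ = closedLoop A B K := by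
  rw [hd, Matrix.add_mul, Matrix.mul_assoc, h.1, Matrix.mul_one, Matrix.sum_mul, closedLoop,
    sub_eq_add_neg, ← Finset.sum_neg_distrib]
  congr 1
  refine Finset.sum_congr rfl fun i _ => ?_
  rw [Matrix.mul_assoc, h.2, Matrix.mul_neg]

theorem SolvesPhi.mul_Xd (hd : d.Explains A B) {K : ∀ i, Matrix (Fin (m i)) (Fin n) ℝ}
    {i : Fin N} {Φ : Matrix (Fin η) (Fin η) ℝ} (h : SolvesPhi d K i Φ) :
    d.Xd * Φ = closedLoop A B K * d.X + B i * d.U i := by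
  have h1 : ∀ j, B j * d.U j * Φ = -(B j * K j * d.X) + if j = i then B j * d.U j else 0 := by
    intro j
    rw [Matrix.mul_assoc, h.2, Matrix.mul_add, Matrix.mul_neg, ← Matrix.mul_assoc]
    split_ifs <;> simp
  rw [hd, Matrix.add_mul, Matrix.mul_assoc, h.1, Matrix.sum_mul, Finset.sum_congr rfl
    (fun j _ => h1 j), Finset.sum_add_distrib, Finset.sum_ite_eq' Finset.univ i,
    if_pos (Finset.mem_univ i), Finset.sum_neg_distrib, closedLoop, Matrix.sub_mul,
    Matrix.sum_mul]
  abel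

/-- The Lyapunov equation cancels the closed-loop terms against `Qbar`, and P S_i P supplies
precisely the quadratic term in X missing from the square. -/
theorem Lbar_eq (hw : w.Admissible) (hd : d.Explains A B)
    {S : Fin N → Matrix (Fin n) (Fin n) ℝ} (hS : ∀ i, S i = B i * (w.R i i)⁻¹ * (B i)ᵀ)
    {K : ∀ i, Matrix (Fin (m i)) (Fin n) ℝ} {i : Fin N} {Φ : Matrix (Fin η) (Fin η) ℝ}
    (hΦ : SolvesPhi d K i Φ) (hP : P.PosDef)
    (hl : P * closedLoop A B K + (closedLoop A B K)ᵀ * P = -w.Qbar K i) :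
    Lbar d w S K i Φ P = (d.U i + gain B w P i * d.X)ᵀ * w.R i i *
      (d.U i + gain B w P i * d.X) := by
  have hSg : P * S i * P = P * (B i * gain B w P i) := by
    rw [hS, gain]
    simp only [Matrix.mul_assoc]
  have h3 : w.R i i * (gain B w P i * d.X) = (B i)ᵀ * (P * d.X) := by
    rw [← Matrix.mul_assoc, mul_gain hw, Matrix.mul_assoc]
  have h4 : ∀ {k : ℕ} (Z : Matrix (Fin (m i)) (Fin k) ℝ),
      (gain B w P i)ᵀ * (w.R i i * Z) = P * (B i * Z) :=
    fun Z => by rw [← Matrix.mul_assoc, transpose_gain_mul hw hP, Matrix.mul_assoc]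
  have h5 : w.Qbar K i = -(P * closedLoop A B K + (closedLoop A B K)ᵀ * P) := by
    rw [hl, neg_neg]
  have h6 : (gain B w P i)ᵀ * ((B i)ᵀ * (P * d.X)) = P * (B i * (gain B w P i * d.X)) := by
    rw [← h3, h4]
  rw [Lbar, Matrix.mul_assoc _ d.Xd, hΦ.mul_Xd hd, ← Matrix.transpose_mul, hΦ.mul_Xd hd, hSg, h5]
  simp only [Matrix.transpose_add, Matrix.transpose_mul, Matrix.mul_add, Matrix.add_mul,
    Matrix.mul_neg, Matrix.neg_mul, Matrix.mul_assoc, h3, h4, h6]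
  abel

theorem dataStep_iff (hw : w.Admissible) (hd : d.Explains A B) (hr : d.IsRich)
    {S : Fin N → Matrix (Fin n) (Fin n) ℝ} (hS : ∀ i, S i = B i * (w.R i i)⁻¹ * (B i)ᵀ)
    {K K' : ∀ i, Matrix (Fin (m i)) (Fin n) ℝ} {P : Fin N → Matrix (Fin n) (Fin n) ℝ} :
    DataStep d w S K P K' ↔ ModelStep A B w K P K' := by
  have hlyap : ∀ {Γ : Matrix (Fin η) (Fin n) ℝ}, SolvesGamma d K Γ → ∀ i,
      P i * d.Xd * Γ + Γᵀ * d.Xdᵀ * P i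
        = P i * closedLoop A B K + (closedLoop A B K)ᵀ * P i := by
    intro Γ hΓ i
    rw [Matrix.mul_assoc, ← Matrix.transpose_mul, hΓ.mul_Xd hd]
  constructor
  · rintro ⟨Γ, Φ, Γb, hΓ, hΦ, hP, hΓb, hK'⟩
    have hP' : ∀ i, (P i).PosDef ∧
        P i * closedLoop A B K + (closedLoop A B K)ᵀ * P i = -w.Qbar K i := fun i =>
      ⟨(hP i).1, by rw [← hlyap hΓ]; exact (hP i).2⟩
    refine ⟨hP', fun i => ?_⟩
    obtain ⟨hX, hL⟩ := hΓb i
    rw [Lbar_eq hw hd hS (hΦ i) (hP' i).1 (hP' i).2, Matrix.mul_assoc, Matrix.add_mul _ _ (Γb i),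
      Matrix.mul_assoc _ d.X, hX, Matrix.mul_one] at hL
    -- As in `DataInit.eq_gain`, Γ' reproduces the residual of the i-th gain and turns the kernel
    -- condition into a vanishing R_ii-square.
    obtain ⟨Γ', hX', hU'⟩ := hr n 0 fun j => d.U j * Γb i + gain B w (P i) j
    have h0 := congrArg (fun M => Γ'ᵀ * M) hL
    simp only [Matrix.mul_zero] at h0
    rw [Matrix.mul_assoc, ← Matrix.mul_assoc Γ'ᵀ, ← Matrix.transpose_mul, Matrix.add_mul,
      Matrix.mul_assoc _ d.X, hX', Matrix.mul_zero, add_zero, hU', ← Matrix.mul_assoc] at h0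
    have h1 := eq_zero_of_transpose_mul_mul (hw.2.1 i) h0
    rw [hK', eq_neg_of_add_eq_zero_left h1, neg_neg, gain]
  · rintro ⟨hP, hK'⟩
    obtain ⟨Γ, hΓX, hΓU⟩ := hr n 1 fun j => -K j
    have hΓ : SolvesGamma d K Γ := ⟨hΓX, hΓU⟩
    have hΦ : ∀ i, ∃ Φ, SolvesPhi d K i Φ := fun i => hr η _ _
    choose Φ hΦ using hΦ
    have hb : ∀ i, ∃ Γb : Matrix (Fin η) (Fin n) ℝ, d.X * Γb = 1 ∧
        ∀ j, d.U j * Γb = -gain B w (P i) j := fun i => hr n 1 _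
    choose Γb hX hU using hb
    refine ⟨Γ, Φ, Γb, hΓ, hΦ, fun i => ⟨(hP i).1, by rw [hlyap hΓ]; exact (hP i).2⟩,
      fun i => ⟨hX i, ?_⟩, fun i => by rw [hU, neg_neg, hK', gain]⟩
    rw [Lbar_eq hw hd hS (hΦ i) (hP i).1 (hP i).2, Matrix.mul_assoc, Matrix.add_mul _ _ (Γb i),
      Matrix.mul_assoc _ d.X, hX, Matrix.mul_one, hU, neg_add_cancel, Matrix.mul_zero]

/-- Two sequences of model-based iterations with the same start agree as long as the closed loops
are Hurwitz. -/
theorem modelStep_sequence_unique {M : ℕ} {K K' : ℕ → ∀ i, Matrix (Fin (m i)) (Fin n) ℝ}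
    {P P' : ℕ → Fin N → Matrix (Fin n) (Fin n) ℝ} (h0 : K' 0 = K 0)
    (h : ∀ k < M, ModelStep A B w (K k) (P k) (K (k + 1)))
    (h' : ∀ k < M, ModelStep A B w (K' k) (P' k) (K' (k + 1)))
    (hH : ∀ k < M, IsHurwitz (closedLoop A B (K k))) :
    ∀ k < M, P' k = P k ∧ K' (k + 1) = K (k + 1) := by
  have step : ∀ k < M, K' k = K k → P' k = P k ∧ K' (k + 1) = K (k + 1) := by
    intro k hk hKk
    have hP : P' k = P k := funext fun i =>
      lyapunov_unique (hH k hk) (Q := -w.Qbar (K k) i)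
        (by rw [← hKk]; exact ((h' k hk).1 i).2) ((h k hk).1 i).2
    exact ⟨hP, funext fun i => by rw [(h' k hk).2, (h k hk).2, hP]⟩
  have hK : ∀ k ≤ M, K' k = K k := by
    intro k
    induction k with
    | zero => exact fun _ => h0
    | succ k ih => exact fun hk => (step k hk (ih (by omega))).2
  exact fun k hk => step k hk (hK k hk.le)

end Algorithms
end NZSGame

/-! ### Equivalence of the algorithms for measured data. -/

theorem theorem1 {n N : ℕ} {m : Fin N → ℕ}
    (A : Matrix (Fin n) (Fin n) ℝ) (B : ∀ i, Matrix (Fin n) (Fin (m i)) ℝ)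
    (w : NZSGame.Weights n N m) (hw : w.Admissible)
    (hAB : NZSGame.IsControllable A (NZSGame.stackCols B))
    (η : ℕ) (T : ℝ) (hT : 0 < T)
    (x : ℝ → Fin n → ℝ) (u : ∀ i, ℝ → Fin (m i) → ℝ)
    (hxu : NZSGame.IsTrajectory A B (η * T) x u)
    (hu : NZSGame.IsPCPE A η T (n + 1) u)
    (Qa : Matrix (Fin n) (Fin n) ℝ) (hQa : Qa.PosSemidef) :
    -- every solution of the auxiliary optimization problem yields an initialization
    (∀ Pa, NZSGame.SolvesLQR (NZSGame.collect η T x u) w Qa Pa →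
      ∃ K0 S, NZSGame.DataInit (NZSGame.collect η T x u) w Qa Pa K0 S) ∧
    -- the linear equations for `Γ` and `Φ_i` are solvable at every iteration
    (∀ K : ∀ i, Matrix (Fin (m i)) (Fin n) ℝ,
      (∃ Γ, NZSGame.SolvesGamma (NZSGame.collect η T x u) K Γ) ∧
      ∀ i, ∃ Φ, NZSGame.SolvesPhi (NZSGame.collect η T x u) K i Φ) ∧
    ∀ Pa K0 S, NZSGame.DataInit (NZSGame.collect η T x u) w Qa Pa K0 S →
      -- the initial feedback matrices are admissible for the model-based algorithm
      NZSGame.IsHurwitz (NZSGame.closedLoop A B K0) ∧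
      -- the two algorithms, started at `K0`, have the same runs
      (∀ (M : ℕ) (K : ℕ → ∀ i, Matrix (Fin (m i)) (Fin n) ℝ)
          (P : ℕ → Fin N → Matrix (Fin n) (Fin n) ℝ),
        NZSGame.DataRun (NZSGame.collect η T x u) w K0 S M K P ↔
          K 0 = K0 ∧ NZSGame.ModelRun A B w M K P) ∧
      -- the results agree as long as the Lyapunov equations are those of Hurwitz matrices
      (∀ (M : ℕ) (K K' : ℕ → ∀ i, Matrix (Fin (m i)) (Fin n) ℝ)
          (P P' : ℕ → Fin N → Matrix (Fin n) (Fin n) ℝ),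
        K 0 = K0 → NZSGame.ModelRun A B w M K P →
        NZSGame.DataRun (NZSGame.collect η T x u) w K0 S M K' P' →
        (∀ k < M, NZSGame.IsHurwitz (NZSGame.closedLoop A B (K k))) →
        ∀ k < M, P' k = P k ∧ K' (k + 1) = K (k + 1)) := by
  have hr : (NZSGame.collect η T x u).IsRich := fun k Y V =>
    NZSGame.collect_exists_solution hAB hT hxu hu Y V
  have hd : (NZSGame.collect η T x u).Explains A B := by
    obtain ⟨μ, hμ, -⟩ := hu
    exact (NZSGame.collect_Xd hT hxu hμ).trans (by rw [NZSGame.stackCols_mul_stackRows])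
  refine ⟨fun Pa h => NZSGame.exists_dataInit hw hd hr h,
    fun K => ⟨hr n 1 _, fun i => hr η _ _⟩, fun Pa K0 S h => ?_⟩
  have hH := h.isHurwitz hw hd hr hAB hQa
  have hS := (h.eq_gain hw hd hr).2
  refine ⟨hH, fun M K P => ⟨fun ⟨h0, hs⟩ => ⟨h0, by rw [h0]; exact hH, fun k hk =>
    (NZSGame.dataStep_iff hw hd hr hS).1 (hs k hk)⟩, fun ⟨h0, _, hs⟩ => ⟨h0, fun k hk =>
    (NZSGame.dataStep_iff hw hd hr hS).2 (hs k hk)⟩⟩, ?_⟩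
  rintro M K K' P P' h0 ⟨-, hm⟩ ⟨h0', hs⟩ hHk
  exact NZSGame.modelStep_sequence_unique (h0'.trans h0.symm) hm
    (fun k hk => (NZSGame.dataStep_iff hw hd hr hS).1 (hs k hk)) hHk
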